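/- **Definitions.** Write $\mathbb R_+=[0,\infty)$ and $x_+=\max(x,0)$. Let $\mathcal V^{\rm pol}$ be the set of nondecreasing right-continuous $v:\mathbb R\to\mathbb R_+$ with $\lim_{x\to-\infty}v(x)=0$, $\lim_{x\to\infty}v(x)=\infty$ and $v(x)\le c(1+x_+^c)$ for all $x\in\mathbb R$, for some constant $c>0$. Let $\mathcal V^{\rm pol}_0$ be the set of $v\in\mathcal V^{\rm pol}$ with $v=0$ on $(-\infty,0)$. Let $C^{\rm pol}$ be the set of continuous members of $\mathcal V^{\rm pol}$, and $C^{\rm pol}_\#$ the set of $v\in C^{\rm pol}$ with $\int_{-\infty}^0 v(x)\,dx<\infty$. Let $C^{\rm pol}_{\rm loc}$ (respectively, $C^{\rm pol}_{\#,{\rm loc}}$) be the set of continuous functions $v$ on $\mathbb R\times(0,\infty)$ such that for every $t>0$ one has $v(\cdot,t)\in C^{\rm pol}$ (respectively, $v(\cdot,t)\in C^{\rm pol}_\#$) and there is $c=c(t)\in(0,\infty)$ with $\sup_{s\in(0,t]}v(x,s)\le c(1+x_+^c)$ for all $x\in\mathbb R$. Let $\mathcal M^{(1)}$ be the set of nonnegative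 Borel measures $\beta$ on $\mathbb R\times\mathbb R_+$ with $\beta(\mathbb R\times[0,t])=t$ for all $t\ge0$. Given $v_0\in\mathcal V^{\rm pol}_0$, a pair $(v,\beta)\in C^{\rm pol}_{\rm loc}\times\mathcal M^{(1)}$ is a *solution of (MFBP) with initial condition $v_0$* if for every $\varphi\in C^\infty_c(\mathbb R\times\mathbb R_+)$ (the restriction to $\mathbb R\times\mathbb R_+$ of a smooth compactly supported function on $\mathbb R^2$, not necessarily vanishing at $t=0$), $$-\int_0^\infty\!\int_{\mathbb R}\Big(\partial_t\varphi+\tfrac12\partial_{xx}\varphi\Big)(x,t)\,v(x,t)\,dx\,dt=\int_{\mathbb R}\varphi(x,0)\,v_0(x)\,dx-\int_{\mathbb R\times\mathbb R_+}\varphi\,d\beta,$$ and $$\int_{\mathbb R\times(0,\infty)}v\,d\beta=0.$$ (That is, $(\partial_t-\frac12\partial_{xx})v=-\beta$ weakly, $v(\cdot,0)=v_0$, and $v=0$ $\beta$-almost everywhere.) **Theorem 4.1.** Let $v_0\in\mathcal V^{\rm pol}_0$ and let $(v^i,\beta^i)\in C^{\rm pol}_{\#,{\rm loc}}\times\mathcal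 M^{(1)}$, $i=1,2$, be two solutions of (MFBP) with initial condition $v_0$. Then $(v^1,\beta^1)=(v^2,\beta^2)$; that is, $v^1(x,t)=v^2(x,t)$ for all $x\in\mathbb R$, $t>0$, and $\beta^1=\beta^2$. -/

import Mathlib

open Set Filter Topology MeasureTheory
open scoped NNReal ENNReal ContDiff

/-- `𝒱^pol(ℝ)`: nondecreasing right-continuous `v : ℝ → ℝ₊` with `v(-∞) = 0`, `v(∞) = ∞` and
`v(x) ≤ c (1 + x₊ ^ c)` for some constant `c > 0`. -/
structure IsVPol (v : ℝ → ℝ) : Prop where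
  nonneg : ∀ x, 0 ≤ v x
  mono : Monotone v
  right_cont : ∀ x, ContinuousWithinAt v (Ici x) x
  tendsto_atBot : Tendsto v atBot (𝓝 0)
  tendsto_atTop : Tendsto v atTop atTop
  growth : ∃ c : ℝ, 0 < c ∧ ∀ x, v x ≤ c * (1 + (max x 0) ^ c)

/-- `𝒱₀^pol(ℝ)`: members of `𝒱^pol(ℝ)` vanishing on `(-∞, 0)`. -/
def IsVPolZero (v : ℝ → ℝ) : Prop :=
  IsVPol v ∧ ∀ x, x < 0 → v x = 0

/-- `𝒱_#^pol(ℝ)`: members of `𝒱^pol(ℝ)` integrable on `(-∞, 0)`. -/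
def IsVPolSharp (v : ℝ → ℝ) : Prop :=
  IsVPol v ∧ IntegrableOn v (Iio 0)

/-- `C^pol(ℝ)`. -/
def IsCPol (v : ℝ → ℝ) : Prop :=
  IsVPol v ∧ Continuous v

/-- `C_#^pol(ℝ)`. -/
def IsCPolSharp (v : ℝ → ℝ) : Prop :=
  IsVPolSharp v ∧ Continuous v

/-- For every `t > 0` there is `c > 0` with `sup_{s ∈ (0,t]} v(x,s) ≤ c (1 + x₊ ^ c)` for all `x`. -/
def HasLocPolGrowth (v : ℝ → ℝ → ℝ) : Prop :=
  ∀ t : ℝ, 0 < t → ∃ c : ℝ, 0 < c ∧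
    ∀ x s : ℝ, s ∈ Ioc 0 t → v x s ≤ c * (1 + (max x 0) ^ c)

/-- `C^pol_loc(ℝ × (0,∞))`. A function on `ℝ × (0,∞)` is given by `v : ℝ → ℝ → ℝ`, space variable
first; the values of `v` at times `t ≤ 0` are never used. -/
structure IsCPolLoc (v : ℝ → ℝ → ℝ) : Prop where
  cont : ContinuousOn (fun p : ℝ × ℝ => v p.1 p.2) (univ ×ˢ Ioi 0)
  slice : ∀ t : ℝ, 0 < t → IsCPol (fun x => v x t)
  growth : HasLocPolGrowth v

/-- `C^pol_{#,loc}(ℝ × (0,∞))`. -/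
structure IsCPolSharpLoc (v : ℝ → ℝ → ℝ) : Prop where
  cont : ContinuousOn (fun p : ℝ × ℝ => v p.1 p.2) (univ ×ˢ Ioi 0)
  slice : ∀ t : ℝ, 0 < t → IsCPolSharp (fun x => v x t)
  growth : HasLocPolGrowth v

/-- `ℳ^(1)(ℝ × ℝ₊)`: Borel measures on `ℝ × ℝ₊` with `β(ℝ × [0,t]) = t` for all `t ≥ 0`. -/
def IsMOne (β : Measure (ℝ × ℝ≥0)) : Prop :=
  ∀ t : ℝ≥0, β (univ ×ˢ Icc 0 t) = (t : ℝ≥0∞)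

/-- `(v, β)` is a solution of the free boundary problem with initial condition `v₀`.
Test functions in `C_c^∞(ℝ × ℝ₊)` are the restrictions to `ℝ × [0,∞)` of smooth compactly
supported functions on `ℝ × ℝ`; in particular they need not vanish at time `0`. -/
structure IsMFBPSolution (v₀ : ℝ → ℝ) (v : ℝ → ℝ → ℝ) (β : Measure (ℝ × ℝ≥0)) : Prop where
  mem_v : IsCPolLoc v
  mem_β : IsMOne β
  weak : ∀ φ : ℝ × ℝ → ℝ, ContDiff ℝ ∞ φ → HasCompactSupport φ →
    -(∫ t in Ioi (0 : ℝ), ∫ x : ℝ,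
        (deriv (fun s => φ (x, s)) t + (1 / 2) * iteratedDeriv 2 (fun y => φ (y, t)) x) * v x t)
      = (∫ x : ℝ, φ (x, 0) * v₀ x) - ∫ p : ℝ × ℝ≥0, φ (p.1, (p.2 : ℝ)) ∂β
  vanish : ∫⁻ p in univ ×ˢ Ioi (0 : ℝ≥0), ENNReal.ofReal (v p.1 (p.2 : ℝ)) ∂β = 0

/-! Consider the primitive of the difference, `u(x,t) = ∫_{y<x} (v₁ - v₂)(y,t) dy`. Formally `∂ₜu =
½ u_xx - (m₁ - m₂)`, where `mᵢ` is the rate at which `βᵢ` puts mass on `(-∞, x)`. If `v₁(x,t) = 0`,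
then `v₁` vanishes on `(-∞, x]` by monotonicity and `u(x,t) ≤ 0`. So `u > 0` forces `v₁(x,t) > 0`;
as `β₁` lives on zeros of `v₁`, all of its mass near time `t` lies left of `x`. There `m₁ = 1 ≥ m₂`,
so `u` is a subsolution of the heat equation where it is positive, and the maximum principle gives
`u ≤ 0`. Exchanging the solutions gives `u = 0`, hence `v₁ = v₂`, and the equation then determines
`β`.

To make this rigorous, the indicator of `(-∞, x)` is replaced by `ramp x δ`. The mollified `u` is
twice differentiable in `x` and satisfies an equation integrated in time
(`IsMFBPSolution.slice_identity`, then `IsMFBPSolution.ramp_identity`). Mollification costs an error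
of order `δ`, so the subsolution property holds only above a small barrier `ε cosh x`
(`IsMFBPSolution.setIntegral_ramp_eq`, `integral_ramp_mul_sub_le`). The maximum principle
`le_mul_exp_mul_cosh_of_subsolution` is built for that situation; then `δ → 0` and `ε → 0`. -/

/-! ### The smooth transition and the approximate identity it generates. -/

theorem Real.smoothTransition.contDiff_infty : ContDiff ℝ ∞ Real.smoothTransition :=
  Real.smoothTransition.contDiff

theorem Real.smoothTransition.contDiff_deriv : ContDiff ℝ ∞ (deriv Real.smoothTransition) :=
  Real.smoothTransition.contDiff_infty.deriv' (n := ∞)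

theorem Real.smoothTransition.deriv_eq_zero {u : ℝ} (hu : u ∉ Icc (0 : ℝ) 1) :
    deriv Real.smoothTransition u = 0 := by
  rw [mem_Icc, not_and_or, not_le, not_le] at hu
  rcases hu with hu | hu
  · have : Real.smoothTransition =ᶠ[𝓝 u] fun _ => 0 := by
      filter_upwards [Iio_mem_nhds hu] with y hy
      exact Real.smoothTransition.zero_of_nonpos (le_of_lt hy)
    rw [this.deriv_eq, deriv_const]
  · have : Real.smoothTransition =ᶠ[𝓝 u] fun _ => 1 := by
      filter_upwards [Ioi_mem_nhds hu] with y hy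
      exact Real.smoothTransition.one_of_one_le (le_of_lt hy)
    rw [this.deriv_eq, deriv_const]

theorem Real.smoothTransition.deriv_deriv_eq_zero {u : ℝ} (hu : u ∉ Icc (0 : ℝ) 1) :
    deriv (deriv Real.smoothTransition) u = 0 := by
  have : deriv Real.smoothTransition =ᶠ[𝓝 u] fun _ => 0 := by
    filter_upwards [isClosed_Icc.isOpen_compl.mem_nhds hu] with y hy
    exact Real.smoothTransition.deriv_eq_zero hy
  rw [this.deriv_eq, deriv_const]

theorem Real.smoothTransition.continuous_deriv_deriv :
    Continuous (deriv (deriv Real.smoothTransition)) :=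
  Real.smoothTransition.contDiff_deriv.continuous_deriv (by simp)

theorem Real.smoothTransition.exists_deriv_bound :
    ∃ M, 0 ≤ M ∧ ∀ u, |deriv Real.smoothTransition u| ≤ M := by
  obtain ⟨M, hM⟩ := (HasCompactSupport.intro isCompact_Icc
    fun _ => Real.smoothTransition.deriv_eq_zero).exists_bound_of_continuous
      Real.smoothTransition.contDiff_deriv.continuous
  exact ⟨M, (norm_nonneg _).trans (hM 0), hM⟩

theorem Real.smoothTransition.exists_deriv_deriv_bound :
    ∃ M, 0 ≤ M ∧ ∀ u, |deriv (deriv Real.smoothTransition) u| ≤ M := by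
  obtain ⟨M, hM⟩ := (HasCompactSupport.intro isCompact_Icc
    fun _ => Real.smoothTransition.deriv_deriv_eq_zero).exists_bound_of_continuous
      Real.smoothTransition.continuous_deriv_deriv
  exact ⟨M, (norm_nonneg _).trans (hM 0), hM⟩

theorem Real.smoothTransition.integral_deriv : ∫ u, deriv Real.smoothTransition u = 1 := by
  rw [← setIntegral_eq_integral_of_forall_compl_eq_zero
    (s := Icc 0 1) (fun _ => Real.smoothTransition.deriv_eq_zero), integral_Icc_eq_integral_Ioc,
    ← intervalIntegral.integral_of_le zero_le_one, intervalIntegral.integral_deriv_eq_sub]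
  · simp
  · exact fun x _ => (Real.smoothTransition.contDiff_infty.differentiable (by simp)).differentiableAt
  · exact Real.smoothTransition.contDiff_deriv.continuous.intervalIntegrable _ _

/-- The derivatives of rescaled smooth transitions form an approximate identity from the right. -/
theorem tendsto_integral_deriv_smoothTransition {f : ℝ → ℝ} (hf : ContinuousOn f (Ioi 0))
    {t : ℝ} (ht : 0 < t) :
    Tendsto (fun n : ℕ => ∫ s in Ioi (0 : ℝ),
      (n + 1 : ℝ) * deriv Real.smoothTransition ((n + 1) * (s - t)) * f s) atTop (𝓝 (f t)) := by
  -- Continuous extension of `f` by its value at `t`; the kernel vanishes left of `t`, so the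
  -- integral does not change.
  set g : ℝ → ℝ := fun s => f (max s t) with hg
  have hgc : Continuous g := by
    refine hf.comp_continuous (by fun_prop) fun s => lt_max_of_lt_right ht
  have hn : ∀ n : ℕ, (0 : ℝ) < n + 1 := fun n => by positivity
  have key : ∀ n : ℕ, ∫ s in Ioi (0 : ℝ),
      (n + 1 : ℝ) * deriv Real.smoothTransition ((n + 1) * (s - t)) * f s
      = ∫ u, deriv Real.smoothTransition u * g (t + u / (n + 1)) := by
    intro n
    have hz : ∀ s < t, deriv Real.smoothTransition ((n + 1) * (s - t)) = 0 := fun s hs =>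
      Real.smoothTransition.deriv_eq_zero fun h =>
        absurd h.1 (not_le.2 (mul_neg_of_pos_of_neg (hn n) (sub_neg.2 hs)))
    rw [setIntegral_eq_integral_of_forall_compl_eq_zero]
    · have e1 : ∀ s, (n + 1 : ℝ) * deriv Real.smoothTransition ((n + 1) * (s - t)) * f s
          = (n + 1 : ℝ) * (fun u => deriv Real.smoothTransition u * g (t + u / (n + 1)))
            ((n + 1) * (s - t)) := by
        intro s
        have : t + (n + 1) * (s - t) / (n + 1) = s := by
          have := (hn n).ne'
          field_simp
          ring
        simp only [this]
        rcases lt_or_ge s t with h | h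
        · simp [hz s h]
        · simp only [hg, max_eq_left h]
          ring
      simp_rw [e1]
      rw [integral_const_mul, integral_sub_right_eq_self
        (fun x => (fun u => deriv Real.smoothTransition u * g (t + u / (n + 1))) ((n + 1) * x)),
        Measure.integral_comp_mul_left
          (fun u => deriv Real.smoothTransition u * g (t + u / (n + 1))),
        abs_of_pos (inv_pos.2 (hn n)), smul_eq_mul, ← mul_assoc, mul_inv_cancel₀ (hn n).ne',
        one_mul]
    · intro s hs
      rw [hz s (lt_of_le_of_lt (not_lt.1 hs) ht)]
      simp
  simp_rw [key]
  obtain ⟨M, hM0, hM⟩ := Real.smoothTransition.exists_deriv_bound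
  obtain ⟨C, hC⟩ := (isCompact_Icc (a := t) (b := t + 1)).exists_bound_of_continuousOn
    hgc.continuousOn
  have hlim : ∫ u, deriv Real.smoothTransition u * g t = f t := by
    rw [integral_mul_const, Real.smoothTransition.integral_deriv, one_mul]
    simp [hg]
  rw [← hlim]
  refine tendsto_integral_of_dominated_convergence ((Icc (0 : ℝ) 1).indicator fun _ => M * C)
    ?_ ?_ ?_ ?_
  · intro n
    have := Real.smoothTransition.contDiff_deriv.continuous
    exact (by fun_prop : Continuous _).aestronglyMeasurable
  · exact (integrable_indicator_iff measurableSet_Icc).2 (integrableOn_const (by simp))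
  · refine fun n => ae_of_all _ fun u => ?_
    by_cases hu : u ∈ Icc (0 : ℝ) 1
    · rw [indicator_of_mem hu, norm_mul]
      refine mul_le_mul (hM u) (hC _ ⟨?_, ?_⟩) (norm_nonneg _) hM0
      · have := div_nonneg hu.1 (hn n).le
        linarith
      · have : u / (n + 1) ≤ 1 := by
          rw [div_le_one (hn n)]
          have : (0 : ℝ) ≤ n := n.cast_nonneg
          linarith [hu.2]
        linarith
    · simp [indicator_of_notMem hu, Real.smoothTransition.deriv_eq_zero hu]
  · refine ae_of_all _ fun u => Tendsto.const_mul _ ?_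
    have : Tendsto (fun n : ℕ => t + u / ((n : ℝ) + 1)) atTop (𝓝 (t + 0)) :=
      tendsto_const_nhds.add (tendsto_const_nhds.div_atTop
        (tendsto_atTop_add_const_right _ _ tendsto_natCast_atTop_atTop))
    rw [add_zero] at this
    exact (hgc.tendsto t).comp this

/-! ### Growth, finiteness and integrability bounds. -/

/-- Replaces the time-dependent polynomial exponent by one fixed rate, slower than that of the
barrier `cosh x`. It follows from `z ≤ e^z` at `z = |x| / (2c)`, raised to the power `c`. -/
theorem HasLocPolGrowth.exists_exp_bound {v : ℝ → ℝ → ℝ} (hv : HasLocPolGrowth v) {T : ℝ}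
    (hT : 0 < T) : ∃ K : ℝ, 0 < K ∧ ∀ x s : ℝ, s ∈ Ioc 0 T → v x s ≤ K * Real.exp (|x| / 2) := by
  obtain ⟨c, hc, h⟩ := hv T hT
  refine ⟨c * (1 + (2 * c) ^ c), by positivity, fun x s hs => (h x s hs).trans ?_⟩
  rw [mul_assoc]
  refine mul_le_mul_of_nonneg_left ?_ hc.le
  have h1 : (1 : ℝ) ≤ Real.exp (|x| / 2) := Real.one_le_exp (by positivity)
  have h2 : (max x 0) ^ c ≤ (2 * c) ^ c * Real.exp (|x| / 2) := by
    have : max x 0 ≤ 2 * c * Real.exp (|x| / (2 * c)) := by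
      have h3 : |x| / (2 * c) ≤ Real.exp (|x| / (2 * c)) := by
        linarith [Real.add_one_le_exp (|x| / (2 * c))]
      rw [div_le_iff₀ (by positivity)] at h3
      have : max x 0 ≤ |x| := max_le (le_abs_self x) (abs_nonneg x)
      linarith
    calc (max x 0) ^ c ≤ (2 * c * Real.exp (|x| / (2 * c))) ^ c :=
          Real.rpow_le_rpow (le_max_right _ _) this hc.le
      _ = (2 * c) ^ c * Real.exp (|x| / 2) := by
          rw [Real.mul_rpow (by positivity) (Real.exp_pos _).le, ← Real.exp_mul]
          congr 2
          field_simp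
  linarith

/-- Points of `ℝ × ℝ₊` with time coordinate at most `t`. -/
def timeSlab (t : ℝ) : Set (ℝ × ℝ≥0) := {p | (p.2 : ℝ) ≤ t}

theorem measurableSet_timeSlab (t : ℝ) : MeasurableSet (timeSlab t) :=
  measurableSet_le (by fun_prop) measurable_const

theorem timeSlab_coe (t : ℝ≥0) : timeSlab t = univ ×ˢ Icc 0 t := by
  ext p
  simp [timeSlab]

theorem IsMOne.measure_timeSlab {β : Measure (ℝ × ℝ≥0)} (hβ : IsMOne β) {t : ℝ} (ht : 0 ≤ t) :
    β (timeSlab t) = ENNReal.ofReal t := by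
  lift t to ℝ≥0 using ht
  rw [timeSlab_coe, hβ, ENNReal.ofReal_coe_nnreal]

theorem IsMOne.isFiniteMeasure_restrict {β : Measure (ℝ × ℝ≥0)} (hβ : IsMOne β) {t : ℝ}
    (ht : 0 ≤ t) : IsFiniteMeasure (β.restrict (timeSlab t)) :=
  ⟨by rw [Measure.restrict_apply_univ, hβ.measure_timeSlab ht]; exact ENNReal.ofReal_lt_top⟩

theorem IsCPolLoc.continuous_slice {v : ℝ → ℝ → ℝ} (hv : IsCPolLoc v) {s : ℝ} (hs : 0 < s) :
    Continuous fun y => v y s := (hv.slice s hs).2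

theorem IsCPolLoc.integrable_mul {v : ℝ → ℝ → ℝ} (hv : IsCPolLoc v) {s : ℝ} (hs : 0 < s)
    {φ : ℝ → ℝ} (hφ : Continuous φ) (hc : HasCompactSupport φ) :
    Integrable fun y => φ y * v y s :=
  (hφ.mul (hv.continuous_slice hs)).integrable_of_hasCompactSupport hc.mul_right

theorem IsCPolLoc.continuousOn_integral {v : ℝ → ℝ → ℝ} (hv : IsCPolLoc v)
    {φ : ℝ → ℝ} (hφ : Continuous φ) (hc : HasCompactSupport φ) :
    ContinuousOn (fun s => ∫ y, φ y * v y s) (Ioi 0) := by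
  refine continuousOn_integral_of_compact_support hc (f := fun s y => φ y * v y s) ?_ ?_
  · refine (hφ.comp continuous_snd).continuousOn.mul ?_
    exact hv.cont.comp continuous_swap.continuousOn fun p hp => ⟨mem_univ _, hp.1⟩
  · intro s y _ hy
    simp [image_eq_zero_of_notMem_tsupport hy]

theorem IsCPolLoc.exists_integral_bound {v : ℝ → ℝ → ℝ} (hv : IsCPolLoc v)
    {φ : ℝ → ℝ} (hφ : Continuous φ) (hc : HasCompactSupport φ) {T : ℝ} (hT : 0 < T) :
    ∃ C, 0 ≤ C ∧ ∀ s ∈ Ioc 0 T, |∫ y, φ y * v y s| ≤ C := by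
  obtain ⟨K, hK, h⟩ := hv.growth.exists_exp_bound hT
  refine ⟨∫ y, |φ y| * (K * Real.exp (|y| / 2)),
    integral_nonneg fun y => by positivity, fun s hs => ?_⟩
  rw [← Real.norm_eq_abs]
  refine norm_integral_le_of_norm_le (g := fun y => |φ y| * (K * Real.exp (|y| / 2))) ?_ ?_
  · refine Continuous.integrable_of_hasCompactSupport (by fun_prop) ?_
    exact HasCompactSupport.mul_right (hc.comp_left (g := abs) abs_zero)
  · refine ae_of_all _ fun y => ?_
    rw [norm_mul]
    refine mul_le_mul_of_nonneg_left ?_ (norm_nonneg _)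
    rw [Real.norm_of_nonneg ((hv.slice s hs.1).1.nonneg y)]
    exact h y s hs

theorem IsVPol.integrable_mul {v₀ : ℝ → ℝ} (hv : IsVPol v₀) {φ : ℝ → ℝ} (hφ : Continuous φ)
    (hc : HasCompactSupport φ) : Integrable fun y => φ y * v₀ y := by
  have : LocallyIntegrable v₀ := hv.mono.locallyIntegrable
  exact this.integrable_smul_left_of_hasCompactSupport hφ hc

theorem integrableOn_Ioi_of_bounded {k : ℝ → ℝ} (hk : AEStronglyMeasurable k (volume.restrict (Ioi 0)))
    {T C : ℝ} (hb : ∀ s ∈ Ioc 0 T, |k s| ≤ C) (h0 : ∀ s, T < s → k s = 0) :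
    IntegrableOn k (Ioi 0) := by
  refine Integrable.mono' (g := (Iic T).indicator fun _ => C) ?_ hk ?_
  · rw [integrable_indicator_iff measurableSet_Iic]
    have : (volume.restrict (Ioi (0 : ℝ))) (Iic T) ≠ ⊤ := by
      rw [Measure.restrict_apply measurableSet_Iic, inter_comm, Ioi_inter_Iic]
      simp
    exact integrableOn_const this
  · refine (ae_restrict_iff' measurableSet_Ioi).2 (ae_of_all _ fun s hs => ?_)
    rcases le_or_gt s T with h | h
    · rw [indicator_of_mem (show s ∈ Iic T from h)]
      exact hb s ⟨hs, h⟩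
    · rw [h0 s h, indicator_of_notMem (show s ∉ Iic T from not_le.2 h), norm_zero]

/-! ### Localisation in time of the weak equation. -/

/-- A smooth approximation of the indicator of `[0, t]` on the positive time axis. -/
noncomputable def timeCutoff (t : ℝ) (n : ℕ) (s : ℝ) : ℝ :=
  -- The first factor only makes the support compact; it equals `1` for `s ≥ -1`.
  Real.smoothTransition (s + 2) * (1 - Real.smoothTransition ((n + 1) * (s - t)))

theorem contDiff_timeCutoff (t : ℝ) (n : ℕ) : ContDiff ℝ ∞ (timeCutoff t n) := by
  refine ContDiff.mul ?_ (contDiff_const.sub ?_)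
  · exact Real.smoothTransition.contDiff_infty.comp (contDiff_id.add contDiff_const)
  · exact Real.smoothTransition.contDiff_infty.comp
      (contDiff_const.mul (contDiff_id.sub contDiff_const))

theorem timeCutoff_of_nonneg {t s : ℝ} {n : ℕ} (hs : 0 ≤ s) :
    timeCutoff t n s = 1 - Real.smoothTransition ((n + 1) * (s - t)) := by
  rw [timeCutoff, Real.smoothTransition.one_of_one_le (by linarith), one_mul]

theorem timeCutoff_eq_one {t s : ℝ} {n : ℕ} (hs : 0 ≤ s) (hst : s ≤ t) :
    timeCutoff t n s = 1 := by
  rw [timeCutoff_of_nonneg hs, Real.smoothTransition.zero_of_nonpos, sub_zero]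
  exact mul_nonpos_of_nonneg_of_nonpos (by positivity) (by linarith)

theorem timeCutoff_eq_zero {t s : ℝ} {n : ℕ} (hst : 1 ≤ (n + 1) * (s - t)) :
    timeCutoff t n s = 0 := by
  rw [timeCutoff, Real.smoothTransition.one_of_one_le hst, sub_self, mul_zero]

theorem one_le_natCast_mul_of_one_le {n : ℕ} {x : ℝ} (hx : 1 ≤ x) : 1 ≤ ((n : ℝ) + 1) * x := by
  have : (0 : ℝ) ≤ n := n.cast_nonneg
  nlinarith

theorem abs_timeCutoff_le (t s : ℝ) (n : ℕ) : |timeCutoff t n s| ≤ 1 := by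
  have h1 := Real.smoothTransition.nonneg (s + 2)
  have h2 := Real.smoothTransition.le_one (s + 2)
  have h3 := Real.smoothTransition.nonneg ((n + 1) * (s - t))
  have h4 := Real.smoothTransition.le_one ((n + 1) * (s - t))
  rw [timeCutoff, abs_of_nonneg (mul_nonneg h1 (by linarith))]
  nlinarith

theorem hasCompactSupport_timeCutoff (t : ℝ) (n : ℕ) : HasCompactSupport (timeCutoff t n) := by
  refine HasCompactSupport.intro (isCompact_Icc (a := -2) (b := t + 1)) fun s hs => ?_
  rw [mem_Icc, not_and_or, not_le, not_le] at hs
  rcases hs with hs | hs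
  · rw [timeCutoff, Real.smoothTransition.zero_of_nonpos (by linarith), zero_mul]
  · exact timeCutoff_eq_zero (one_le_natCast_mul_of_one_le (by linarith))

theorem deriv_timeCutoff {t s : ℝ} {n : ℕ} (hs : 0 < s) :
    deriv (timeCutoff t n) s = -((n + 1) * deriv Real.smoothTransition ((n + 1) * (s - t))) := by
  have h : timeCutoff t n =ᶠ[𝓝 s] fun s => 1 - Real.smoothTransition ((n + 1) * (s - t)) := by
    filter_upwards [Ioi_mem_nhds hs] with y hy
    exact timeCutoff_of_nonneg (le_of_lt hy)
  rw [h.deriv_eq]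
  have h1 : HasDerivAt (fun s : ℝ => ((n : ℝ) + 1) * (s - t)) (n + 1) s := by
    simpa using ((hasDerivAt_id s).sub_const t).const_mul ((n : ℝ) + 1)
  have h2 := ((Real.smoothTransition.contDiff_infty.differentiable (by simp)).differentiableAt
    (x := ((n : ℝ) + 1) * (s - t))).hasDerivAt
  refine ((h2.comp s h1).const_sub 1).deriv.trans ?_
  ring

theorem tendsto_timeCutoff {t s : ℝ} (hs : 0 ≤ s) :
    Tendsto (fun n => timeCutoff t n s) atTop (𝓝 ((Iic t).indicator (fun _ => 1) s)) := by
  rcases le_or_gt s t with h | h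
  · rw [indicator_of_mem (show s ∈ Iic t from h)]
    simp_rw [timeCutoff_eq_one hs h]
    exact tendsto_const_nhds
  · rw [indicator_of_notMem (show s ∉ Iic t from not_le.2 h)]
    refine tendsto_const_nhds.congr' ?_
    obtain ⟨N, hN⟩ := exists_nat_gt (1 / (s - t))
    filter_upwards [eventually_ge_atTop N] with n hn
    have h0 : 0 < s - t := sub_pos.2 h
    rw [timeCutoff_eq_zero]
    rw [div_lt_iff₀ h0] at hN
    have : (N : ℝ) ≤ n := Nat.cast_le.2 hn
    nlinarith

/-- The weak formulation tested against a function of the space variable, up to time `t`. -/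
theorem IsMFBPSolution.slice_identity {v₀ : ℝ → ℝ} {v : ℝ → ℝ → ℝ} {β : Measure (ℝ × ℝ≥0)}
    (h : IsMFBPSolution v₀ v β) {φ : ℝ → ℝ} (hφ : ContDiff ℝ ∞ φ) (hc : HasCompactSupport φ)
    {t : ℝ} (ht : 0 < t) :
    ∫ y, φ y * v y t = (∫ y, φ y * v₀ y)
      + 1 / 2 * (∫ r in Ioc 0 t, ∫ y, deriv (deriv φ) y * v y r)
      - ∫ p in timeSlab t, φ p.1 ∂β := by
  have hv := h.mem_v
  have hβ := h.mem_β
  have hφ' : ContDiff ℝ ∞ (deriv φ) := hφ.deriv' (n := ∞)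
  have hφ2 : Continuous (deriv (deriv φ)) := hφ'.continuous_deriv (by simp)
  have hc2 : HasCompactSupport (deriv (deriv φ)) := hc.deriv.deriv
  set f : ℝ → ℝ := fun s => ∫ y, φ y * v y s with hf
  set g : ℝ → ℝ := fun s => ∫ y, deriv (deriv φ) y * v y s with hg
  have hfc : ContinuousOn f (Ioi 0) := hv.continuousOn_integral hφ.continuous hc
  have hgc : ContinuousOn g (Ioi 0) := hv.continuousOn_integral hφ2 hc2
  -- All the cutoffs vanish beyond `t + 1`, so bounds on `(0, t + 1]` are uniform in `n`.
  have ht1 : 0 < t + 1 := by linarith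
  obtain ⟨Cf, hCf0, hCf⟩ := hv.exists_integral_bound hφ.continuous hc ht1
  obtain ⟨Cg, hCg0, hCg⟩ := hv.exists_integral_bound hφ2 hc2 ht1
  obtain ⟨M, hM0, hM⟩ := Real.smoothTransition.exists_deriv_bound
  have ecut : ∀ n s, t + 1 < s → timeCutoff t n s = 0 := fun n s hs =>
    timeCutoff_eq_zero (one_le_natCast_mul_of_one_le (by linarith))
  have i1 : ∀ n : ℕ, IntegrableOn (fun s =>
      (n + 1 : ℝ) * deriv Real.smoothTransition ((n + 1) * (s - t)) * f s) (Ioi 0) := by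
    intro n
    refine integrableOn_Ioi_of_bounded (T := t + 1) (C := (n + 1) * M * Cf) ?_ ?_ ?_
    · refine ContinuousOn.aestronglyMeasurable ?_ measurableSet_Ioi
      have := Real.smoothTransition.contDiff_deriv.continuous
      exact (by fun_prop : Continuous _).continuousOn.mul hfc
    · intro s hs
      rw [abs_mul, abs_mul, abs_of_nonneg (by positivity : (0 : ℝ) ≤ n + 1)]
      exact mul_le_mul (mul_le_mul_of_nonneg_left (hM _) (by positivity)) (hCf s hs)
        (abs_nonneg _) (by positivity)
    · intro s hs
      rw [Real.smoothTransition.deriv_eq_zero]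
      · ring
      · refine fun hmem => absurd hmem.2 (not_le.2 ?_)
        have : (0 : ℝ) ≤ n := n.cast_nonneg
        nlinarith
  have m2 : ∀ n : ℕ, AEStronglyMeasurable (fun s => timeCutoff t n s * g s)
      (volume.restrict (Ioi 0)) := fun n =>
    ((contDiff_timeCutoff t n).continuous.continuousOn.mul hgc).aestronglyMeasurable
      measurableSet_Ioi
  have b2 : ∀ (n : ℕ), ∀ s ∈ Ioc 0 (t + 1), |timeCutoff t n s * g s| ≤ Cg := by
    intro n s hs
    rw [abs_mul]
    calc _ ≤ 1 * Cg := mul_le_mul (abs_timeCutoff_le _ _ _) (hCg s hs) (abs_nonneg _) zero_le_one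
      _ = Cg := one_mul _
  have i2 : ∀ n : ℕ, IntegrableOn (fun s => timeCutoff t n s * g s) (Ioi 0) := fun n =>
    integrableOn_Ioi_of_bounded (m2 n) (b2 n) fun s hs => by rw [ecut n s hs, zero_mul]
  -- Test with `φ(x)` times the time cutoff: minus the derivative of the cutoff is an approximate
  -- identity at `t`, and its value `1` at time `0` produces the initial term.
  have weak : ∀ n : ℕ,
      (∫ s in Ioi (0 : ℝ), (n + 1 : ℝ) * deriv Real.smoothTransition ((n + 1) * (s - t)) * f s)
      = (∫ y, φ y * v₀ y) + 1 / 2 * (∫ s in Ioi (0 : ℝ), timeCutoff t n s * g s)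
        - ∫ p : ℝ × ℝ≥0, φ p.1 * timeCutoff t n p.2 ∂β := by
    intro n
    have w := h.weak (fun p => φ p.1 * timeCutoff t n p.2)
      ((hφ.comp contDiff_fst).mul ((contDiff_timeCutoff t n).comp contDiff_snd))
      (by
        refine HasCompactSupport.intro (hc.isCompact.prod (hasCompactSupport_timeCutoff t n)) ?_
        rintro ⟨x, s⟩ hx
        rw [mem_prod, not_and_or] at hx
        rcases hx with hx | hx
        · simp [image_eq_zero_of_notMem_tsupport hx]
        · simp [image_eq_zero_of_notMem_tsupport hx])
    have hinner : ∀ s ∈ Ioi (0 : ℝ), (∫ x : ℝ,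
        (deriv (fun s => φ x * timeCutoff t n s) s
          + (1 / 2) * iteratedDeriv 2 (fun y => φ y * timeCutoff t n s) x) * v x s)
        = -((n + 1 : ℝ) * deriv Real.smoothTransition ((n + 1) * (s - t)) * f s)
          + 1 / 2 * (timeCutoff t n s * g s) := by
      intro s hs
      have e : ∀ x, (deriv (fun s => φ x * timeCutoff t n s) s
          + (1 / 2) * iteratedDeriv 2 (fun y => φ y * timeCutoff t n s) x) * v x s
          = deriv (timeCutoff t n) s * (φ x * v x s)
            + 1 / 2 * timeCutoff t n s * (deriv (deriv φ) x * v x s) := by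
        intro x
        have e1 : iteratedDeriv 2 (fun y => φ y * timeCutoff t n s) x
            = deriv (deriv φ) x * timeCutoff t n s := by
          rw [iteratedDeriv_succ, iteratedDeriv_one]
          simp only [deriv_mul_const_field']
        rw [e1, deriv_const_mul_field]
        ring
      simp_rw [e]
      rw [integral_add ((hv.integrable_mul hs hφ.continuous hc).const_mul _)
        ((hv.integrable_mul hs hφ2 hc2).const_mul _), integral_const_mul, integral_const_mul,
        deriv_timeCutoff hs]
      simp only [hf, hg]
      ring
    rw [setIntegral_congr_fun measurableSet_Ioi hinner]
      at w
    have hadd := integral_add (i1 n).neg ((i2 n).const_mul (1 / 2))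
    simp only [Pi.neg_apply] at hadd
    rw [hadd, integral_neg, integral_const_mul] at w
    simp only [timeCutoff_eq_one le_rfl ht.le, mul_one] at w
    linarith
  have l1 := tendsto_integral_deriv_smoothTransition hfc ht
  have l2 : Tendsto (fun n => ∫ s in Ioi (0 : ℝ), timeCutoff t n s * g s) atTop
      (𝓝 (∫ r in Ioc 0 t, g r)) := by
    have e : ∫ r in Ioc 0 t, g r
        = ∫ s in Ioi (0 : ℝ), (Iic t).indicator (fun _ => (1 : ℝ)) s * g s := by
      have : ∀ s, (Iic t).indicator (fun _ => (1 : ℝ)) s * g s = (Iic t).indicator g s := by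
        intro s
        by_cases hs : s ∈ Iic t <;> simp [hs]
      simp_rw [this]
      rw [setIntegral_indicator measurableSet_Iic, Ioi_inter_Iic]
    rw [e]
    refine tendsto_integral_of_dominated_convergence ((Iic (t + 1)).indicator fun _ => Cg)
      m2 ?_ ?_ ?_
    · exact integrableOn_Ioi_of_bounded (T := t + 1) (C := Cg)
        ((measurable_const.indicator measurableSet_Iic).aestronglyMeasurable)
        (fun s hs => by simp [hs.2, abs_of_nonneg hCg0]) (fun s hs => by simp [hs])
    · refine fun n => (ae_restrict_iff' measurableSet_Ioi).2 (ae_of_all _ fun s hs => ?_)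
      rcases le_or_gt s (t + 1) with h | h
      · rw [indicator_of_mem (show s ∈ Iic (t + 1) from h)]
        exact b2 n s ⟨hs, h⟩
      · rw [indicator_of_notMem (show s ∉ Iic (t + 1) from not_le.2 h), ecut n s h, zero_mul,
          norm_zero]
    · exact (ae_restrict_iff' measurableSet_Ioi).2 (ae_of_all _ fun s hs =>
        (tendsto_timeCutoff (le_of_lt hs)).mul_const _)
  -- The cutoffs equal `1` at `s = t`, so they converge everywhere to the indicator of the closed
  -- slab.
  have l3 : Tendsto (fun n => ∫ p : ℝ × ℝ≥0, φ p.1 * timeCutoff t n p.2 ∂β) atTop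
      (𝓝 (∫ p in timeSlab t, φ p.1 ∂β)) := by
    obtain ⟨Cφ, hCφ⟩ := hc.exists_bound_of_continuous hφ.continuous
    rw [← integral_indicator (measurableSet_timeSlab t)]
    refine tendsto_integral_of_dominated_convergence ((timeSlab (t + 1)).indicator fun _ => Cφ)
      ?_ ?_ ?_ ?_
    · intro n
      have := hφ.continuous
      have := (contDiff_timeCutoff t n).continuous
      exact (by fun_prop : Continuous fun p : ℝ × ℝ≥0 =>
        φ p.1 * timeCutoff t n p.2).aestronglyMeasurable
    · rw [integrable_indicator_iff (measurableSet_timeSlab _)]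
      refine integrableOn_const ?_
      rw [hβ.measure_timeSlab ht1.le]
      exact ENNReal.ofReal_ne_top
    · refine fun n => ae_of_all _ fun p => ?_
      by_cases hp : p ∈ timeSlab (t + 1)
      · rw [indicator_of_mem hp, norm_mul]
        calc _ ≤ Cφ * 1 := mul_le_mul (hCφ _) (abs_timeCutoff_le _ _ _) (abs_nonneg _)
              ((norm_nonneg _).trans (hCφ 0))
          _ = Cφ := mul_one _
      · rw [indicator_of_notMem hp, ecut n _ (not_le.1 hp), mul_zero, norm_zero]
    · refine ae_of_all _ fun p => ?_
      have := (tendsto_timeCutoff (t := t) (NNReal.coe_nonneg p.2)).const_mul (φ p.1)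
      convert this using 2
      by_cases hp : p ∈ timeSlab t
      · rw [indicator_of_mem hp, indicator_of_mem (show (p.2 : ℝ) ∈ Iic t from hp), mul_one]
      · rw [indicator_of_notMem hp, indicator_of_notMem (show (p.2 : ℝ) ∉ Iic t from hp), mul_zero]
  refine tendsto_nhds_unique l1 ?_
  simp_rw [weak]
  exact (tendsto_const_nhds.add (l2.const_mul _)).sub l3

/-! ### Ramps and mollified primitives in space. -/

/-- A smooth nonincreasing function equal to `1` on `(-∞, x - δ]` and to `0` on `[x, ∞)`. -/
noncomputable def ramp (x δ y : ℝ) : ℝ := Real.smoothTransition ((x - y) / δ)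

theorem contDiff_ramp (x δ : ℝ) : ContDiff ℝ ∞ (ramp x δ) :=
  Real.smoothTransition.contDiff_infty.comp ((contDiff_const.sub contDiff_id).div_const δ)

theorem continuous_ramp (x δ : ℝ) : Continuous (ramp x δ) := (contDiff_ramp x δ).continuous

theorem ramp_nonneg (x δ y : ℝ) : 0 ≤ ramp x δ y := Real.smoothTransition.nonneg _

theorem ramp_le_one (x δ y : ℝ) : ramp x δ y ≤ 1 := Real.smoothTransition.le_one _

theorem abs_ramp_le_one (x δ y : ℝ) : |ramp x δ y| ≤ 1 := by
  rw [abs_of_nonneg (ramp_nonneg x δ y)]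
  exact ramp_le_one x δ y

theorem ramp_eq_one {x δ y : ℝ} (hδ : 0 < δ) (h : y ≤ x - δ) : ramp x δ y = 1 :=
  Real.smoothTransition.one_of_one_le ((one_le_div hδ).2 (by linarith))

theorem ramp_eq_zero {x δ y : ℝ} (hδ : 0 < δ) (h : x ≤ y) : ramp x δ y = 0 :=
  Real.smoothTransition.zero_of_nonpos (div_nonpos_of_nonpos_of_nonneg (by linarith) hδ.le)

theorem sub_div_mem_Icc_iff {x δ y : ℝ} (hδ : 0 < δ) :
    (x - y) / δ ∈ Icc (0 : ℝ) 1 ↔ y ∈ Icc (x - δ) x := by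
  rw [mem_Icc, mem_Icc, le_div_iff₀ hδ, div_le_iff₀ hδ]
  constructor <;> rintro ⟨h1, h2⟩ <;> constructor <;> linarith

theorem deriv_deriv_ramp (x δ y : ℝ) :
    deriv (deriv (ramp x δ)) y = deriv (deriv Real.smoothTransition) ((x - y) / δ) / δ / δ := by
  have h1 : ∀ y, HasDerivAt (fun y : ℝ => (x - y) / δ) (-1 / δ) y := fun y =>
    ((hasDerivAt_id y).const_sub x).div_const δ
  have e : deriv (ramp x δ) = fun y => deriv Real.smoothTransition ((x - y) / δ) * (-1 / δ) := by
    funext y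
    exact (((Real.smoothTransition.contDiff_infty.differentiable
      (by simp)).differentiableAt.hasDerivAt).comp y (h1 y)).deriv
  rw [e]
  refine (((((Real.smoothTransition.contDiff_deriv.differentiable
      (by simp)).differentiableAt.hasDerivAt).comp y (h1 y)).mul_const (-1 / δ)).deriv).trans ?_
  ring

theorem deriv_deriv_ramp_eq_zero {x δ y : ℝ} (hδ : 0 < δ) (hy : y ∉ Icc (x - δ) x) :
    deriv (deriv (ramp x δ)) y = 0 := by
  rw [deriv_deriv_ramp, Real.smoothTransition.deriv_deriv_eq_zero, zero_div, zero_div]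
  rwa [sub_div_mem_Icc_iff hδ]

theorem continuous_deriv_deriv_ramp (x δ : ℝ) : Continuous (deriv (deriv (ramp x δ))) :=
  ((contDiff_ramp x δ).deriv' (n := ∞)).continuous_deriv (by simp)

theorem hasCompactSupport_deriv_deriv_ramp {x δ : ℝ} (hδ : 0 < δ) :
    HasCompactSupport (deriv (deriv (ramp x δ))) :=
  HasCompactSupport.intro isCompact_Icc fun _ => deriv_deriv_ramp_eq_zero hδ

theorem tendsto_ramp (x y : ℝ) : Tendsto (fun n : ℕ => ramp x (1 / (n + 1)) y) atTop
    (𝓝 ((Iio x).indicator (fun _ => 1) y)) := by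
  have hn : ∀ n : ℕ, (0 : ℝ) < 1 / (n + 1) := fun n => by positivity
  rcases lt_or_ge y x with h | h
  · rw [indicator_of_mem (show y ∈ Iio x from h)]
    refine tendsto_const_nhds.congr' ?_
    have := tendsto_one_div_add_atTop_nhds_zero_nat (𝕜 := ℝ)
    filter_upwards [this.eventually (Iic_mem_nhds (sub_pos.2 h))] with n hle
    rw [ramp_eq_one (hn n)]
    have : 1 / ((n : ℝ) + 1) ≤ x - y := hle
    linarith
  · rw [indicator_of_notMem (show y ∉ Iio x from not_lt.2 h)]
    simp_rw [ramp_eq_zero (hn _) h]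
    exact tendsto_const_nhds

theorem integrableOn_Iic_of_Iio_zero {f : ℝ → ℝ} (hf : LocallyIntegrable f)
    (h0 : IntegrableOn f (Iio 0)) (x : ℝ) : IntegrableOn f (Iic x) := by
  refine (h0.union (hf.integrableOn_isCompact (isCompact_Icc (a := 0) (b := x)))).mono_set ?_
  intro y hy
  rcases lt_or_ge y 0 with h | h
  · exact Or.inl h
  · exact Or.inr ⟨h, hy⟩

theorem IsCPolSharpLoc.integrableOn_Iic {v : ℝ → ℝ → ℝ} (hv : IsCPolSharpLoc v) {s : ℝ}
    (hs : 0 < s) (x : ℝ) : IntegrableOn (fun y => v y s) (Iic x) :=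
  integrableOn_Iic_of_Iio_zero (hv.slice s hs).2.locallyIntegrable (hv.slice s hs).1.2 x

theorem IsVPolZero.integrableOn_Iic {v₀ : ℝ → ℝ} (hv : IsVPolZero v₀) (x : ℝ) :
    IntegrableOn v₀ (Iic x) :=
  integrableOn_Iic_of_Iio_zero hv.1.mono.locallyIntegrable
    (integrableOn_zero.congr_fun (fun y hy => (hv.2 y hy).symm) measurableSet_Iio) x

/-- A ramp is not compactly supported on the left, which is why integrability at `-∞` is needed. -/
theorem integrable_ramp_mul {f : ℝ → ℝ} (x : ℝ) (hf : IntegrableOn f (Iic x)) {δ : ℝ}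
    (hδ : 0 < δ) : Integrable fun y => ramp x δ y * f y := by
  have : IntegrableOn (fun y => ramp x δ y * f y) (Iic x) :=
    hf.bdd_mul (c := 1) (continuous_ramp x δ).aestronglyMeasurable
      (ae_of_all _ fun y => abs_ramp_le_one x δ y)
  refine (integrableOn_iff_integrable_of_support_subset ?_).1 this
  intro y hy
  by_contra h
  exact hy (by simp only [ramp_eq_zero hδ (le_of_lt (not_le.1 h)), zero_mul])

theorem tendsto_integral_ramp_mul {f : ℝ → ℝ} (x : ℝ) (hf : IntegrableOn f (Iic x)) :
    Tendsto (fun n : ℕ => ∫ y, ramp x (1 / (n + 1)) y * f y) atTop (𝓝 (∫ y in Iio x, f y)) := by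
  have hn : ∀ n : ℕ, (0 : ℝ) < 1 / (n + 1) := fun n => by positivity
  rw [← integral_indicator measurableSet_Iio]
  refine tendsto_integral_of_dominated_convergence ((Iic x).indicator fun y => |f y|)
    (fun n => (integrable_ramp_mul x hf (hn n)).aestronglyMeasurable)
    ((integrable_indicator_iff measurableSet_Iic).2 hf.abs) ?_ ?_
  · refine fun n => ae_of_all _ fun y => ?_
    rcases le_or_gt y x with h | h
    · rw [indicator_of_mem (show y ∈ Iic x from h), norm_mul]
      exact mul_le_of_le_one_left (norm_nonneg _) (abs_ramp_le_one _ _ _)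
    · rw [indicator_of_notMem (show y ∉ Iic x from not_le.2 h), ramp_eq_zero (hn n) h.le,
        zero_mul, norm_zero]
  · refine ae_of_all _ fun y => ?_
    convert (tendsto_ramp x y).mul_const (f y) using 2
    by_cases hy : y ∈ Iio x <;> simp [hy]

/-- Differentiation of a rescaled convolution. -/
theorem hasDerivAt_integral_comp_sub_div {g f : ℝ → ℝ} (hg : Differentiable ℝ g)
    (hg' : Continuous (deriv g)) (hg0 : ∀ u ∉ Icc (0 : ℝ) 1, deriv g u = 0) {M : ℝ}
    (hM : ∀ u, |deriv g u| ≤ M) (hf : Continuous f) {δ : ℝ} (hδ : 0 < δ) (x : ℝ)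
    (hi : Integrable fun y => g ((x - y) / δ) * f y) :
    HasDerivAt (fun x => ∫ y, g ((x - y) / δ) * f y)
      (∫ y, deriv g ((x - y) / δ) / δ * f y) x := by
  -- For `z` within `1` of `x`, the kernel `deriv g ((z - y) / δ)` lives on `y ∈ [z - δ, z]`, inside
  -- the support of the bound below.
  have hgc := hg.continuous
  refine (hasDerivAt_integral_of_dominated_loc_of_deriv_le (s := Icc (x - 1) (x + 1))
    (bound := (Icc (x - 1 - δ) (x + 1)).indicator fun y => M / δ * |f y|)
    (F' := fun x y => deriv g ((x - y) / δ) / δ * f y)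
    (Icc_mem_nhds (by linarith) (by linarith))
    (Eventually.of_forall fun z => ?_) hi ?_ (ae_of_all _ fun y z hz => ?_) ?_
    (ae_of_all _ fun y z hz => ?_)).2
  · exact (by fun_prop : Continuous _).aestronglyMeasurable
  · exact (by fun_prop : Continuous _).aestronglyMeasurable
  · by_cases hy : y ∈ Icc (x - 1 - δ) (x + 1)
    · rw [indicator_of_mem hy, norm_mul, norm_div, Real.norm_of_nonneg hδ.le]
      exact mul_le_mul (div_le_div_of_nonneg_right (hM _) hδ.le) le_rfl (norm_nonneg _)
        (div_nonneg ((abs_nonneg _).trans (hM 0)) hδ.le)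
    · rw [indicator_of_notMem hy, hg0, zero_div, zero_mul, norm_zero]
      rw [sub_div_mem_Icc_iff hδ]
      exact fun h => hy ⟨by linarith [h.1, hz.1], by linarith [h.2, hz.2]⟩
  · rw [integrable_indicator_iff measurableSet_Icc]
    exact (by fun_prop : Continuous _).integrableOn_Icc
  · have h1 : HasDerivAt (fun z : ℝ => (z - y) / δ) (1 / δ) z :=
      ((hasDerivAt_id z).sub_const y).div_const δ
    refine HasDerivAt.mul_const ?_ (f y)
    have := (hg ((z - y) / δ)).hasDerivAt.comp z h1
    rwa [mul_one_div] at this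

/-- The ramp depends on `x - y` only, so two derivatives in `x` agree with two in `y`. The second
space derivative of the mollified primitive is thus the very integral in the weak equation. -/
theorem deriv_integral_ramp_mul {f : ℝ → ℝ} (hf : Continuous f)
    (hi : ∀ x, IntegrableOn f (Iic x)) {δ : ℝ} (hδ : 0 < δ) :
    (∀ x, DifferentiableAt ℝ (fun x => ∫ y, ramp x δ y * f y) x) ∧
    ∀ x, HasDerivAt (deriv fun x => ∫ y, ramp x δ y * f y)
      (∫ y, deriv (deriv (ramp x δ)) y * f y) x := by
  obtain ⟨M, -, hM⟩ := Real.smoothTransition.exists_deriv_bound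
  obtain ⟨M', -, hM'⟩ := Real.smoothTransition.exists_deriv_deriv_bound
  have h1 : ∀ x, HasDerivAt (fun x => ∫ y, ramp x δ y * f y)
      (∫ y, deriv Real.smoothTransition ((x - y) / δ) / δ * f y) x := fun x =>
    hasDerivAt_integral_comp_sub_div
      (Real.smoothTransition.contDiff_infty.differentiable (by simp))
      Real.smoothTransition.contDiff_deriv.continuous
      (fun _ => Real.smoothTransition.deriv_eq_zero) hM hf hδ x (integrable_ramp_mul x (hi x) hδ)
  refine ⟨fun x => (h1 x).differentiableAt, fun x => ?_⟩
  -- The factor `1 / δ` moves onto `f`, so that the same differentiation lemma applies again.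
  have e : (deriv fun x => ∫ y, ramp x δ y * f y)
      = fun x => ∫ y, deriv Real.smoothTransition ((x - y) / δ) * (f y / δ) := by
    funext x
    rw [(h1 x).deriv]
    congr 1
    funext y
    ring
  rw [e]
  have hfd : Continuous fun y => f y / δ := by fun_prop
  have hσ := Real.smoothTransition.contDiff_deriv.continuous
  have := hasDerivAt_integral_comp_sub_div (f := fun y => f y / δ)
    (Real.smoothTransition.contDiff_deriv.differentiable (by simp))
    Real.smoothTransition.continuous_deriv_deriv
    (fun _ => Real.smoothTransition.deriv_deriv_eq_zero) hM' hfd hδ x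
    (Continuous.integrable_of_hasCompactSupport (by fun_prop)
      (HasCompactSupport.intro (isCompact_Icc (a := x - δ) (b := x)) fun y hy => by
        rw [Real.smoothTransition.deriv_eq_zero, zero_mul]
        rwa [sub_div_mem_Icc_iff hδ]))
  convert this using 3 with y
  rw [deriv_deriv_ramp]
  ring

/-! ### The weak equation for a ramp, by truncation at `-∞`. -/

/-- The time-integrated equation tested against a ramp. -/
theorem IsMFBPSolution.ramp_identity {v₀ : ℝ → ℝ} {v : ℝ → ℝ → ℝ} {β : Measure (ℝ × ℝ≥0)}
    (h : IsMFBPSolution v₀ v β) (hv₀ : IsVPolZero v₀) (hs : IsCPolSharpLoc v) (x : ℝ) {δ t : ℝ}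
    (hδ : 0 < δ) (ht : 0 < t) :
    ∫ y, ramp x δ y * v y t = (∫ y, ramp x δ y * v₀ y)
      + 1 / 2 * (∫ r in Ioc 0 t, ∫ y, deriv (deriv (ramp x δ)) y * v y r)
      - ∫ p in timeSlab t, ramp x δ p.1 ∂β := by
  have hv := h.mem_v
  have hβ := h.mem_β
  -- With this shift the truncation near `-R n` takes place entirely where the ramp is `1`.
  set R : ℕ → ℝ := fun n => n + (|x| + δ) with hR
  have hRx : ∀ n, -R n ≤ x - δ := fun n => by
    have : (0 : ℝ) ≤ n := n.cast_nonneg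
    simp only [hR]
    linarith [neg_abs_le x]
  have hR0 : ∀ n, 0 ≤ R n := fun n => by positivity
  have hRt : Tendsto R atTop atTop :=
    tendsto_atTop_add_const_right _ _ tendsto_natCast_atTop_atTop
  set χ : ℕ → ℝ → ℝ := fun n y => Real.smoothTransition (y + (R n + 1)) with hχ
  have hχs : ∀ n, ContDiff ℝ ∞ (χ n) := fun n =>
    Real.smoothTransition.contDiff_infty.comp (contDiff_id.add contDiff_const)
  have hχ0 : ∀ n y, y ≤ -R n - 1 → χ n y = 0 := fun n y hy =>
    Real.smoothTransition.zero_of_nonpos (by linarith)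
  have hχ1 : ∀ n y, -R n ≤ y → χ n y = 1 := fun n y hy =>
    Real.smoothTransition.one_of_one_le (by linarith)
  have hχb : ∀ n y, |χ n y| ≤ 1 := fun n y => by
    rw [abs_of_nonneg (Real.smoothTransition.nonneg _)]
    exact Real.smoothTransition.le_one _
  have hχt : ∀ y, Tendsto (fun n => χ n y) atTop (𝓝 1) := fun y => by
    refine tendsto_const_nhds.congr' ?_
    filter_upwards [hRt.eventually_ge_atTop (-y)] with n hn
    rw [hχ1 n y (by linarith)]
  have hχ2 : ∀ n y, deriv (deriv (χ n)) y
      = deriv (deriv Real.smoothTransition) (y + (R n + 1)) := by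
    intro n y
    have e : deriv (χ n) = fun y => deriv Real.smoothTransition (y + (R n + 1)) := by
      funext y
      exact deriv_comp_add_const _ _ _
    rw [e]
    exact deriv_comp_add_const _ _ _
  have hχ2z : ∀ n, ∀ y ∉ Icc (-R n - 1) (-R n), deriv (deriv (χ n)) y = 0 := by
    intro n y hy
    rw [hχ2, Real.smoothTransition.deriv_deriv_eq_zero]
    exact fun hm => hy ⟨by linarith [hm.1], by linarith [hm.2]⟩
  have hχ2c : ∀ n, Continuous (deriv (deriv (χ n))) := fun n =>
    ((hχs n).deriv' (n := ∞)).continuous_deriv (by simp)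
  have hχ2s : ∀ n, HasCompactSupport (deriv (deriv (χ n))) := fun n =>
    HasCompactSupport.intro isCompact_Icc (hχ2z n)
  set φ : ℕ → ℝ → ℝ := fun n y => χ n y * ramp x δ y with hφ
  have hφs : ∀ n, ContDiff ℝ ∞ (φ n) := fun n => (hχs n).mul (contDiff_ramp x δ)
  have hφc : ∀ n, HasCompactSupport (φ n) := by
    refine fun n => HasCompactSupport.intro (isCompact_Icc (a := -R n - 1) (b := x)) fun y hy => ?_
    rw [mem_Icc, not_and_or, not_le, not_le] at hy
    rcases hy with hy | hy
    · simp only [hφ, hχ0 n y hy.le, zero_mul]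
    · simp only [hφ, ramp_eq_zero hδ hy.le, mul_zero]
  -- At each point one of the two factors is `1`, so the product is a sum up to a constant and its
  -- second derivative has no cross term.
  have hφe : ∀ n, φ n = fun y => χ n y + (ramp x δ y - 1) := by
    intro n
    funext y
    rcases le_total y (x - δ) with hy | hy
    · simp only [hφ, ramp_eq_one hδ hy]
      ring
    · simp only [hφ, hχ1 n y ((hRx n).trans hy)]
      ring
  have hφ2 : ∀ n y, deriv (deriv (φ n)) y
      = deriv (deriv (χ n)) y + deriv (deriv (ramp x δ)) y := by
    intro n y
    have e : deriv (φ n) = fun y => deriv (χ n) y + deriv (ramp x δ) y := by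
      funext y
      rw [hφe, deriv_fun_add ((hχs n).differentiable (by simp)).differentiableAt
        (((contDiff_ramp x δ).differentiable (by simp)).differentiableAt.sub_const 1),
        deriv_sub_const_fun]
    rw [e, deriv_fun_add]
    · exact (((hχs n).deriv' (n := ∞)).differentiable (by simp)).differentiableAt
    · exact (((contDiff_ramp x δ).deriv' (n := ∞)).differentiable (by simp)).differentiableAt
  have hid := fun n => h.slice_identity (hφs n) (hφc n) ht
  have lspace : ∀ f : ℝ → ℝ, IntegrableOn f (Iic x) →
      Tendsto (fun n => ∫ y, φ n y * f y) atTop (𝓝 (∫ y, ramp x δ y * f y)) := by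
    intro f hf
    have hi := integrable_ramp_mul x hf hδ
    have e : ∀ n y, φ n y * f y = χ n y * (ramp x δ y * f y) := fun n y => by
      simp only [hφ]
      ring
    simp_rw [e]
    refine tendsto_integral_of_dominated_convergence (fun y => |ramp x δ y * f y|)
      (fun n => (hχs n).continuous.aestronglyMeasurable.mul hi.aestronglyMeasurable) hi.abs
      (fun n => ae_of_all _ fun y => ?_) (ae_of_all _ fun y => ?_)
    · rw [norm_mul]
      exact mul_le_of_le_one_left (norm_nonneg _) (hχb n y)
    · simpa using (hχt y).mul_const (ramp x δ y * f y)
  have lβ : Tendsto (fun n => ∫ p in timeSlab t, φ n p.1 ∂β) atTop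
      (𝓝 (∫ p in timeSlab t, ramp x δ p.1 ∂β)) := by
    have := hβ.isFiniteMeasure_restrict ht.le
    refine tendsto_integral_of_dominated_convergence (fun _ => 1) (fun n => ?_)
      (integrable_const _) (fun n => ae_of_all _ fun p => ?_) (ae_of_all _ fun p => ?_)
    · exact ((hφs n).continuous.comp continuous_fst).aestronglyMeasurable
    · rw [norm_mul]
      exact mul_le_one₀ (hχb n _) (norm_nonneg _) (abs_ramp_le_one _ _ _)
    · simpa using (hχt p.1).mul_const (ramp x δ p.1)
  have hr2c := continuous_deriv_deriv_ramp x δ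
  have hr2s := hasCompactSupport_deriv_deriv_ramp (x := x) hδ
  obtain ⟨C, hC0, hC⟩ := hv.exists_integral_bound hr2c hr2s ht
  obtain ⟨M, hM0, hM⟩ := Real.smoothTransition.exists_deriv_deriv_bound
  obtain ⟨K, hK0, hK⟩ := hv.growth.exists_exp_bound ht
  -- The truncation error lives on an interval of length `1` ending at `-R n`; monotonicity bounds
  -- it, and `v(-∞) = 0` sends it to `0`. Domination in time uses `v (-R n) r ≤ v 0 r ≤ K`.
  have hχbound : ∀ n, ∀ r ∈ Ioc 0 t,
      |∫ y, deriv (deriv (χ n)) y * v y r| ≤ M * v (-R n) r := by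
    intro n r hr
    have hvr := (hv.slice r hr.1).1
    have : M * v (-R n) r
        = ∫ y, (Icc (-R n - 1) (-R n)).indicator (fun _ => M * v (-R n) r) y := by
      rw [integral_indicator measurableSet_Icc, setIntegral_const]
      simp
    rw [this, ← Real.norm_eq_abs]
    refine norm_integral_le_of_norm_le ?_ (ae_of_all _ fun y => ?_)
    · rw [integrable_indicator_iff measurableSet_Icc]
      exact integrableOn_const (by simp)
    · by_cases hy : y ∈ Icc (-R n - 1) (-R n)
      · rw [indicator_of_mem hy, norm_mul, Real.norm_of_nonneg (hvr.nonneg y), hχ2]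
        exact mul_le_mul (hM _) (hvr.mono hy.2) (hvr.nonneg y) hM0
      · rw [indicator_of_notMem hy, hχ2z n y hy, zero_mul, norm_zero]
  have hsplit : ∀ n, ∀ r ∈ Ioc 0 t, ∫ y, deriv (deriv (φ n)) y * v y r
      = (∫ y, deriv (deriv (χ n)) y * v y r) + ∫ y, deriv (deriv (ramp x δ)) y * v y r := by
    intro n r hr
    simp_rw [hφ2, add_mul]
    exact integral_add (hv.integrable_mul hr.1 (hχ2c n) (hχ2s n))
      (hv.integrable_mul hr.1 hr2c hr2s)
  have ltime : Tendsto (fun n => ∫ r in Ioc 0 t, ∫ y, deriv (deriv (φ n)) y * v y r) atTop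
      (𝓝 (∫ r in Ioc 0 t, ∫ y, deriv (deriv (ramp x δ)) y * v y r)) := by
    refine tendsto_integral_of_dominated_convergence (fun _ => M * K + C) (fun n => ?_)
      (integrableOn_const (by simp)) (fun n => ?_) ?_
    · refine ((hv.continuousOn_integral ?_ (hφc n).deriv.deriv).mono
        Ioc_subset_Ioi_self).aestronglyMeasurable measurableSet_Ioc
      exact ((hφs n).deriv' (n := ∞)).continuous_deriv (by simp)
    · refine (ae_restrict_iff' measurableSet_Ioc).2 (ae_of_all _ fun r hr => ?_)
      rw [hsplit n r hr]
      refine (norm_add_le _ _).trans (add_le_add ((hχbound n r hr).trans ?_) (hC r hr))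
      refine mul_le_mul_of_nonneg_left ?_ hM0
      have h1 := hK 0 r hr
      have h2 := (hv.slice r hr.1).1.mono (show -R n ≤ 0 by linarith [hR0 n])
      simp only [abs_zero, zero_div, Real.exp_zero, mul_one] at h1
      exact h2.trans h1
    · refine (ae_restrict_iff' measurableSet_Ioc).2 (ae_of_all _ fun r hr => ?_)
      have h0 : Tendsto (fun n => ∫ y, deriv (deriv (χ n)) y * v y r) atTop (𝓝 0) := by
        refine squeeze_zero_norm (fun n => hχbound n r hr) ?_
        have := ((hv.slice r hr.1).1.tendsto_atBot.comp
          (tendsto_neg_atTop_atBot.comp hRt)).const_mul M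
        rwa [mul_zero] at this
      have := h0.add_const (∫ y, deriv (deriv (ramp x δ)) y * v y r)
      rw [zero_add] at this
      exact this.congr fun n => (hsplit n r hr).symm
  refine tendsto_nhds_unique (lspace _ (hs.integrableOn_Iic ht x)) ?_
  simp_rw [hid]
  exact ((lspace _ (hv₀.integrableOn_Iic x)).add (ltime.const_mul _)).sub lβ

/-! ### Ingredients of the maximum principle. -/

/-- If `a > 0`, the second derivative test makes `x` a local minimum as well, so `f` is locally
constant and `a = 0`. -/
theorem IsLocalMax.le_zero_of_hasDerivAt_deriv {f : ℝ → ℝ} {x a : ℝ} (h : IsLocalMax f x)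
    (hf : ContinuousAt f x) (hd : HasDerivAt (deriv f) a x) : a ≤ 0 := by
  by_contra! ha
  have hmin : IsLocalMin f x :=
    isLocalMin_of_deriv_deriv_pos (by rwa [hd.deriv]) h.deriv_eq_zero hf
  have hconst : f =ᶠ[𝓝 x] fun _ => f x := by
    filter_upwards [h, hmin] with y h1 h2 using le_antisymm h1 h2
  have : deriv f =ᶠ[𝓝 x] fun _ => 0 := by
    filter_upwards [hconst.eventuallyEq_nhds] with y hy
    rw [hy.deriv_eq, deriv_const]
  rw [← hd.deriv, this.deriv_eq, deriv_const] at ha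
  exact lt_irrefl _ ha

theorem IsMOne.measure_timeSlab_diff {β : Measure (ℝ × ℝ≥0)} (hβ : IsMOne β) {s t : ℝ}
    (hs : 0 ≤ s) (hst : s ≤ t) : β (timeSlab t \ timeSlab s) = ENNReal.ofReal (t - s) := by
  have hsub : timeSlab s ⊆ timeSlab t := fun p hp => le_trans hp hst
  rw [measure_sdiff hsub (measurableSet_timeSlab s).nullMeasurableSet, hβ.measure_timeSlab hs,
    hβ.measure_timeSlab (hs.trans hst), ENNReal.ofReal_sub _ hs]
  rw [hβ.measure_timeSlab hs]
  exact ENNReal.ofReal_ne_top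

theorem IsMOne.setIntegral_one_timeSlab_diff {β : Measure (ℝ × ℝ≥0)} (hβ : IsMOne β) {s t : ℝ}
    (hs : 0 ≤ s) (hst : s ≤ t) : ∫ _ in timeSlab t \ timeSlab s, (1 : ℝ) ∂β = t - s := by
  rw [setIntegral_const, smul_eq_mul, mul_one, Measure.real, hβ.measure_timeSlab_diff hs hst,
    ENNReal.toReal_ofReal (sub_nonneg.2 hst)]

theorem IsMOne.integrableOn_ramp {β : Measure (ℝ × ℝ≥0)} (hβ : IsMOne β) (x δ : ℝ) {t : ℝ}
    (ht : 0 ≤ t) : IntegrableOn (fun p => ramp x δ p.1) (timeSlab t) β := by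
  have := hβ.isFiniteMeasure_restrict ht
  exact Integrable.mono' (integrable_const (1 : ℝ))
    ((continuous_ramp x δ).comp continuous_fst).aestronglyMeasurable
    (ae_of_all _ fun p => abs_ramp_le_one _ _ _)

theorem setIntegral_ramp_nonneg (β : Measure (ℝ × ℝ≥0)) (x δ s t : ℝ) :
    0 ≤ ∫ p in timeSlab t \ timeSlab s, ramp x δ p.1 ∂β :=
  integral_nonneg fun _ => ramp_nonneg _ _ _

theorem IsMOne.setIntegral_ramp_le {β : Measure (ℝ × ℝ≥0)} (hβ : IsMOne β) (x δ : ℝ) {s t : ℝ}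
    (hs : 0 ≤ s) (hst : s ≤ t) : ∫ p in timeSlab t \ timeSlab s, ramp x δ p.1 ∂β ≤ t - s := by
  rw [← hβ.setIntegral_one_timeSlab_diff hs hst]
  refine integral_mono ((hβ.integrableOn_ramp x δ (hs.trans hst)).mono_set sdiff_subset)
    (integrableOn_const ?_) fun p => ramp_le_one _ _ _
  rw [hβ.measure_timeSlab_diff hs hst]
  exact ENNReal.ofReal_ne_top

theorem IsMFBPSolution.ae_nonpos {v₀ : ℝ → ℝ} {v : ℝ → ℝ → ℝ} {β : Measure (ℝ × ℝ≥0)}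
    (h : IsMFBPSolution v₀ v β) : ∀ᵐ p ∂β, 0 < p.2 → v p.1 p.2 ≤ 0 := by
  have hm : MeasurableSet ((univ : Set ℝ) ×ˢ Ioi (0 : ℝ≥0)) :=
    MeasurableSet.univ.prod measurableSet_Ioi
  have hc : ContinuousOn (fun p : ℝ × ℝ≥0 => v p.1 (p.2 : ℝ)) (univ ×ˢ Ioi (0 : ℝ≥0)) :=
    h.mem_v.cont.comp (f := fun p : ℝ × ℝ≥0 => (p.1, (p.2 : ℝ)))
      (by fun_prop : Continuous _).continuousOn
      fun p hp => ⟨mem_univ _, NNReal.coe_pos.2 hp.2⟩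
  have := (lintegral_eq_zero_iff' (hc.aemeasurable hm).ennreal_ofReal).1 h.vanish
  filter_upwards [(ae_restrict_iff' hm).1 this] with p hp hpos
  exact ENNReal.ofReal_eq_zero.1 (hp ⟨mem_univ _, hpos⟩)

/-- The measure charges only zeros of `v`; by monotonicity those at times in `(s, t]` lie left of `x
- δ`, where the ramp is `1`. So the ramp sees the full mass, the largest value possible. -/
theorem IsMFBPSolution.setIntegral_ramp_eq {v₀ : ℝ → ℝ} {v : ℝ → ℝ → ℝ}
    {β : Measure (ℝ × ℝ≥0)} (h : IsMFBPSolution v₀ v β) {x δ s t : ℝ} (hδ : 0 < δ)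
    (hs : 0 ≤ s) (hst : s ≤ t) (hpos : ∀ r ∈ Ioc s t, 0 < v (x - δ) r) :
    ∫ p in timeSlab t \ timeSlab s, ramp x δ p.1 ∂β = t - s := by
  rw [← h.mem_β.setIntegral_one_timeSlab_diff hs hst]
  refine setIntegral_congr_ae ((measurableSet_timeSlab t).diff (measurableSet_timeSlab s)) ?_
  filter_upwards [h.ae_nonpos] with p hp hmem
  have h1 : s < p.2 := not_le.1 hmem.2
  have h2 : (0 : ℝ) < p.2 := hs.trans_lt h1
  refine ramp_eq_one hδ (le_of_lt ?_)
  by_contra! hle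
  have := (h.mem_v.slice _ h2).1.mono hle
  exact absurd ((hpos _ ⟨h1, hmem.1⟩).trans_le this) (not_lt.2 (hp (NNReal.coe_pos.1 h2)))

theorem exp_half_le_two_mul_cosh (x : ℝ) : Real.exp (|x| / 2) ≤ 2 * Real.cosh x := by
  rw [← Real.cosh_abs, Real.cosh_eq]
  have h1 : Real.exp (|x| / 2) ≤ Real.exp |x| := Real.exp_le_exp.2 (by linarith [abs_nonneg x])
  have h2 := Real.exp_pos (-|x|)
  linarith

/-! ### The maximum principle. -/

/-- A maximum principle on `ℝ × [0, T]` with subexponential growth, in which the subsolution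
property is only required where `U` is larger than `ε cosh`. -/
theorem le_mul_exp_mul_cosh_of_subsolution {U A : ℝ → ℝ → ℝ} {T ε L : ℝ} (hT : 0 < T)
    (hε : 0 < ε) (hL0 : 0 ≤ L) (hU0 : ∀ x, U x 0 = 0)
    (hUd : ∀ s ∈ Ioc 0 T, Differentiable ℝ fun x => U x s)
    (hUdd : ∀ s ∈ Ioc 0 T, ∀ x, HasDerivAt (deriv fun x => U x s) (A x s) x)
    (hAc : ∀ x, ContinuousOn (A x) (Ioi 0))
    (hlip : ∀ x, ∀ s t, 0 ≤ s → s ≤ t → t ≤ T →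
      |U x t - U x s| ≤ (L * Real.exp (|x| / 2) + 1) * (t - s))
    (hsub : ∀ x, ∀ t ∈ Ioc 0 T, ε * Real.cosh x < U x t →
      ∀ᶠ s in 𝓝[<] t, U x t - U x s ≤ 1 / 2 * ∫ r in s..t, A x r) (x₀ : ℝ) :
    U x₀ T ≤ ε * Real.exp T * Real.cosh x₀ := by
  by_contra! hcon
  -- The second entry makes the barrier beat the bound on `U` at `|x| = R`, through `e^(R/2) > R/2`
  -- and `(e^(R/2))² ≤ 2 cosh R`.
  set R : ℝ := max (|x₀|) (2 * (2 * (L + 1) * T / ε)) with hR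
  have hR0 : 0 ≤ R := (abs_nonneg _).trans (le_max_left _ _)
  have hRexp : (L * Real.exp (R / 2) + 1) * T < ε * Real.cosh R := by
    have e0 : 2 * (L + 1) * T / ε < Real.exp (R / 2) := by
      have := Real.add_one_le_exp (R / 2)
      have := le_max_right (|x₀|) (2 * (2 * (L + 1) * T / ε))
      rw [← hR] at this
      linarith
    rw [div_lt_iff₀ hε] at e0
    have e1 : 1 ≤ Real.exp (R / 2) := Real.one_le_exp (by positivity)
    have e2 : Real.exp (R / 2) * Real.exp (R / 2) ≤ 2 * Real.cosh R := by
      rw [← Real.exp_add, add_halves, Real.cosh_eq]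
      linarith [Real.exp_pos (-R)]
    nlinarith
  set Z : ℝ × ℝ → ℝ := fun p => U p.2 p.1 - ε * Real.exp p.1 * Real.cosh p.2 with hZ
  have hUc : ContinuousOn (fun p : ℝ × ℝ => U p.2 p.1) (Icc 0 T ×ˢ Icc (-R) R) := by
    refine continuousOn_prod_of_continuousOn_lipschitzOnWith _
      (Real.toNNReal (L * Real.exp (R / 2) + 1)) (fun s hs => ?_) fun x hx => ?_
    · rcases hs.1.eq_or_lt with h0 | h0
      · subst h0
        simp only [hU0]
        exact continuousOn_const
      · exact (hUd s ⟨h0, hs.2⟩).continuous.continuousOn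
    · have hle : ∀ s t, 0 ≤ s → s ≤ t → t ≤ T →
          |U x t - U x s| ≤ (L * Real.exp (R / 2) + 1) * |t - s| := by
        intro s t hs hst ht
        rw [abs_of_nonneg (sub_nonneg.2 hst)]
        refine (hlip x s t hs hst ht).trans
          (mul_le_mul_of_nonneg_right ?_ (sub_nonneg.2 hst))
        have : |x| ≤ R := abs_le.2 hx
        have := Real.exp_le_exp.2 (show |x| / 2 ≤ R / 2 by linarith)
        nlinarith
      refine LipschitzOnWith.of_dist_le_mul fun s hs t ht => ?_
      rw [Real.coe_toNNReal _ (by positivity), Real.dist_eq, Real.dist_eq]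
      rcases le_total s t with hst | hst
      · rw [abs_sub_comm, abs_sub_comm s t]
        exact hle s t hs.1 hst ht.2
      · exact hle t s ht.1 hst hs.2
  have hZc : ContinuousOn Z (Icc 0 T ×ˢ Icc (-R) R) := by
    have := Real.continuous_cosh
    exact hUc.sub (by fun_prop : Continuous fun p : ℝ × ℝ =>
      ε * Real.exp p.1 * Real.cosh p.2).continuousOn
  have hmem0 : (T, x₀) ∈ Icc 0 T ×ˢ Icc (-R) R :=
    ⟨⟨hT.le, le_rfl⟩, abs_le.1 (le_max_left _ _)⟩
  obtain ⟨⟨t₁, x₁⟩, hmem, hmax⟩ :=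
    (isCompact_Icc.prod isCompact_Icc).exists_isMaxOn ⟨_, hmem0⟩ hZc
  have hZpos : 0 < Z (t₁, x₁) := by
    refine lt_of_lt_of_le ?_ (hmax hmem0)
    simp only [hZ]
    linarith
  simp only [hZ] at hZpos
  have hcosh : 0 < Real.cosh x₁ := Real.cosh_pos x₁
  have ht₁ : 0 < t₁ := by
    rcases hmem.1.1.eq_or_lt with h0 | h0
    · change 0 = t₁ at h0
      rw [← h0, hU0] at hZpos
      have : 0 < ε * Real.exp 0 * Real.cosh x₁ := by positivity
      linarith
    · exact h0
  have ht₁T : t₁ ≤ T := hmem.1.2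
  -- On the lateral boundary, the Lipschitz bound from `U x 0 = 0` keeps `U` below the barrier.
  have hx₁ : |x₁| < R := by
    refine lt_of_le_of_ne (abs_le.2 hmem.2) fun heq => ?_
    have e1 := hlip x₁ 0 t₁ le_rfl ht₁.le ht₁T
    rw [hU0, sub_zero, sub_zero, heq] at e1
    rw [← Real.cosh_abs, heq] at hZpos
    have e2 : (L * Real.exp (R / 2) + 1) * t₁ ≤ (L * Real.exp (R / 2) + 1) * T :=
      mul_le_mul_of_nonneg_left ht₁T (by positivity)
    have e3 : 1 ≤ Real.exp t₁ := Real.one_le_exp ht₁.le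
    have e4 : 0 < ε * Real.cosh R := mul_pos hε (Real.cosh_pos R)
    have e5 := le_abs_self (U x₁ t₁)
    nlinarith
  -- The barrier is at least `ε cosh x`, so a positive maximum lies where the subsolution property
  -- is available.
  have hUbig : ε * Real.cosh x₁ < U x₁ t₁ := by
    have e3 : 1 ≤ Real.exp t₁ := Real.one_le_exp ht₁.le
    have e4 : 0 < ε * Real.cosh x₁ := by positivity
    nlinarith
  have hmax' : ∀ s ∈ Icc 0 T, ∀ x ∈ Icc (-R) R, U x s - ε * Real.exp s * Real.cosh x
      ≤ U x₁ t₁ - ε * Real.exp t₁ * Real.cosh x₁ := fun s hs x hx =>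
    isMaxOn_iff.1 hmax (s, x) ⟨hs, hx⟩
  have hA₁ : A x₁ t₁ ≤ ε * Real.exp t₁ * Real.cosh x₁ := by
    have d1 := hUd t₁ ⟨ht₁, ht₁T⟩
    have hloc : IsLocalMax (fun x => U x t₁ - ε * Real.exp t₁ * Real.cosh x) x₁ := by
      filter_upwards [Ioo_mem_nhds (abs_lt.1 hx₁).1 (abs_lt.1 hx₁).2] with x hx
      exact hmax' t₁ hmem.1 x ⟨hx.1.le, hx.2.le⟩
    have hder : HasDerivAt (deriv fun x => U x t₁ - ε * Real.exp t₁ * Real.cosh x)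
        (A x₁ t₁ - ε * Real.exp t₁ * Real.cosh x₁) x₁ := by
      have e : (deriv fun x => U x t₁ - ε * Real.exp t₁ * Real.cosh x)
          = fun x => deriv (fun x => U x t₁) x - ε * Real.exp t₁ * Real.sinh x := by
        funext x
        exact ((d1 x).hasDerivAt.sub ((Real.hasDerivAt_cosh x).const_mul _)).deriv
      rw [e]
      exact (hUdd t₁ ⟨ht₁, ht₁T⟩ x₁).sub ((Real.hasDerivAt_sinh x₁).const_mul _)
    have := hloc.le_zero_of_hasDerivAt_deriv
      (d1.continuous.sub (Real.continuous_cosh.const_mul _)).continuousAt hder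
    linarith
  set E : ℝ := ε * Real.exp t₁ * Real.cosh x₁ with hE
  have hE0 : 0 < E := by positivity
  -- At the maximum the barrier grows at rate `E`, while `A / 2 ≤ E / 2`. The slope `5/8` lies
  -- strictly between, and by continuity separates the two just before `t₁`: `U` would have to
  -- increase both by at most and by more than `5/8 * E * (t₁ - s)`.
  have hev : ∀ᶠ r in 𝓝 t₁, 0 < r ∧ A x₁ r < 5 / 4 * E ∧ 5 / 8 * Real.exp t₁ < Real.exp r := by
    have c1 : ContinuousAt (A x₁) t₁ := (hAc x₁).continuousAt (Ioi_mem_nhds ht₁)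
    refine (eventually_gt_nhds ht₁).and
      ((c1.eventually_lt_const (by linarith)).and
        (Real.continuous_exp.continuousAt.eventually_const_lt ?_))
    linarith [Real.exp_pos t₁]
  obtain ⟨l, hl, hIoc⟩ := exists_Ioc_subset_of_mem_nhds hev ⟨0, ht₁⟩
  obtain ⟨s, hinc, hls, hst⟩ := ((hsub x₁ t₁ ⟨ht₁, ht₁T⟩ hUbig).and
    (Ioo_mem_nhdsLT (show l < t₁ from hl))).exists
  have hgood : ∀ r ∈ Icc s t₁, 0 < r ∧ A x₁ r < 5 / 4 * E ∧ 5 / 8 * Real.exp t₁ < Real.exp r :=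
    fun r hr => hIoc ⟨hls.trans_le hr.1, hr.2⟩
  have hs0 : 0 < s := (hgood s ⟨le_rfl, hst.le⟩).1
  have hint : ∫ r in s..t₁, A x₁ r ≤ (t₁ - s) * (5 / 4 * E) := by
    have : ∫ _ in s..t₁, (5 / 4 * E) = (t₁ - s) * (5 / 4 * E) := by
      rw [intervalIntegral.integral_const, smul_eq_mul]
    rw [← this]
    refine intervalIntegral.integral_mono_on hst.le ?_ intervalIntegrable_const
      fun r hr => (hgood r hr).2.1.le
    refine ((hAc x₁).mono fun r hr => ?_).intervalIntegrable
    rw [uIcc_of_le hst.le] at hr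
    exact (hgood r hr).1
  have hmaxs := hmax' s ⟨hs0.le, hst.le.trans ht₁T⟩ x₁ hmem.2
  have hexp : Real.exp s * (t₁ - s) ≤ Real.exp t₁ - Real.exp s := by
    have e1 := Real.add_one_le_exp (t₁ - s)
    have e2 : Real.exp t₁ = Real.exp s * Real.exp (t₁ - s) := by
      rw [← Real.exp_add]
      ring_nf
    rw [e2]
    nlinarith [Real.exp_pos s]
  have hs5 := (hgood s ⟨le_rfl, hst.le⟩).2.2
  have hεc : 0 < ε * Real.cosh x₁ := by positivity
  have f1 : ε * Real.cosh x₁ * (5 / 8 * Real.exp t₁) * (t₁ - s)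
      < ε * Real.cosh x₁ * (Real.exp s) * (t₁ - s) :=
    mul_lt_mul_of_pos_right (mul_lt_mul_of_pos_left hs5 hεc) (sub_pos.2 hst)
  have f2 := mul_le_mul_of_nonneg_left hexp hεc.le
  simp only [hE] at hint
  nlinarith

/-! ### Comparison of two solutions. -/

/-- Comparison of the ramp averages of two solutions, up to a small supersolution. -/
theorem integral_ramp_mul_sub_le {v₀ : ℝ → ℝ} {v₁ v₂ : ℝ → ℝ → ℝ} {β₁ β₂ : Measure (ℝ × ℝ≥0)}
    (hv₀ : IsVPolZero v₀) (hv₁ : IsCPolSharpLoc v₁) (hv₂ : IsCPolSharpLoc v₂)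
    (h₁ : IsMFBPSolution v₀ v₁ β₁) (h₂ : IsMFBPSolution v₀ v₂ β₂) {T K ε δ : ℝ} (hT : 0 < T)
    (hK₁ : ∀ x s : ℝ, s ∈ Ioc 0 T → v₁ x s ≤ K * Real.exp (|x| / 2))
    (hK₂ : ∀ x s : ℝ, s ∈ Ioc 0 T → v₂ x s ≤ K * Real.exp (|x| / 2))
    (hK : 0 < K) (hε : 0 < ε) (hδ : 0 < δ) (hδε : 2 * (δ * K) < ε) (x₀ : ℝ) :
    ∫ y, ramp x₀ δ y * (v₁ y T - v₂ y T) ≤ ε * Real.exp T * Real.cosh x₀ := by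
  have hr2c := fun x => continuous_deriv_deriv_ramp x δ
  have hr2s := fun x => hasCompactSupport_deriv_deriv_ramp (x := x) hδ
  set u : ℝ → ℝ → ℝ := fun x s => ∫ y, ramp x δ y * (v₁ y s - v₂ y s) with hu
  set A : ℝ → ℝ → ℝ := fun x s => ∫ y, deriv (deriv (ramp x δ)) y * (v₁ y s - v₂ y s) with hA
  -- `U` is the right-hand side of the equation for `u`. Unlike `u`, it is meaningful at time `0`,
  -- where the values of `v₁` and `v₂` are arbitrary.
  set U : ℝ → ℝ → ℝ := fun x s => 1 / 2 * (∫ r in (0 : ℝ)..s, A x r)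
    - ((∫ p in timeSlab s, ramp x δ p.1 ∂β₁) - ∫ p in timeSlab s, ramp x δ p.1 ∂β₂) with hU
  have hAeq : ∀ x, ∀ s > 0, A x s = (∫ y, deriv (deriv (ramp x δ)) y * v₁ y s)
      - ∫ y, deriv (deriv (ramp x δ)) y * v₂ y s := by
    intro x s hs
    simp only [hA, mul_sub]
    exact integral_sub (h₁.mem_v.integrable_mul hs (hr2c x) (hr2s x))
      (h₂.mem_v.integrable_mul hs (hr2c x) (hr2s x))
  have hAc : ∀ x, ContinuousOn (A x) (Ioi 0) := fun x =>
    ((h₁.mem_v.continuousOn_integral (hr2c x) (hr2s x)).sub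
      (h₂.mem_v.continuousOn_integral (hr2c x) (hr2s x))).congr fun s hs => hAeq x s hs
  have hi : ∀ s > 0, ∀ x, IntegrableOn (fun y => v₁ y s - v₂ y s) (Iic x) := fun s hs x =>
    (hv₁.integrableOn_Iic hs x).sub (hv₂.integrableOn_Iic hs x)
  have hcw : ∀ s > 0, Continuous fun y => v₁ y s - v₂ y s := fun s hs =>
    (hv₁.slice s hs).2.sub (hv₂.slice s hs).2
  obtain ⟨M, hM0, hM⟩ := Real.smoothTransition.exists_deriv_deriv_bound
  -- Bound `M / δ²` for the kernel, times `K`, times the length `δ` of its support.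
  set L : ℝ := M / δ / δ * K * δ with hL
  have hL0 : 0 ≤ L := by positivity
  have hAb : ∀ x, ∀ s ∈ Ioc 0 T, |A x s| ≤ L * Real.exp (|x| / 2) := by
    intro x s hs
    have : L * Real.exp (|x| / 2) = ∫ y, (Icc (x - δ) x).indicator
        (fun _ => M / δ / δ * (K * Real.exp (|x| / 2))) y := by
      rw [integral_indicator measurableSet_Icc, setIntegral_const]
      simp only [Real.volume_real_Icc, smul_eq_mul, sub_sub_cancel, max_eq_left hδ.le, hL]
      ring
    rw [this, ← Real.norm_eq_abs]
    refine norm_integral_le_of_norm_le ?_ (ae_of_all _ fun y => ?_)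
    · rw [integrable_indicator_iff measurableSet_Icc]
      exact integrableOn_const (by simp)
    · by_cases hy : y ∈ Icc (x - δ) x
      · have w1 := (hv₁.slice s hs.1).1.1
        have w2 := (hv₂.slice s hs.1).1.1
        rw [indicator_of_mem hy, norm_mul, deriv_deriv_ramp, norm_div, norm_div,
          Real.norm_of_nonneg hδ.le]
        refine mul_le_mul ?_ ?_ (norm_nonneg _) (by positivity)
        · exact div_le_div_of_nonneg_right (div_le_div_of_nonneg_right (hM _) hδ.le) hδ.le
        · rw [Real.norm_eq_abs, abs_le]
          have a1 := (w1.mono hy.2).trans (hK₁ x s hs)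
          have a2 := (w2.mono hy.2).trans (hK₂ x s hs)
          have a3 := w1.nonneg y
          have a4 := w2.nonneg y
          constructor <;> linarith
      · rw [indicator_of_notMem hy, deriv_deriv_ramp_eq_zero hδ hy, zero_mul, norm_zero]
  have hAi : ∀ x, IntegrableOn (A x) (Ioc 0 T) := fun x =>
    Integrable.mono' (integrableOn_const (C := L * Real.exp (|x| / 2)) (by simp))
      (((hAc x).mono Ioc_subset_Ioi_self).aestronglyMeasurable measurableSet_Ioc)
      ((ae_restrict_iff' measurableSet_Ioc).2 (ae_of_all _ (hAb x)))
  have hAii : ∀ x, ∀ s ∈ Icc 0 T, IntervalIntegrable (A x) volume 0 s := fun x s hs =>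
    (intervalIntegrable_iff_integrableOn_Ioc_of_le hs.1).2
      ((hAi x).mono_set (Ioc_subset_Ioc_right hs.2))
  have huU : ∀ x, ∀ s ∈ Ioc 0 T, u x s = U x s := by
    intro x s hs
    have e1 := h₁.ramp_identity hv₀ hv₁ x hδ hs.1
    have e2 := h₂.ramp_identity hv₀ hv₂ x hδ hs.1
    have e3 : u x s = (∫ y, ramp x δ y * v₁ y s) - ∫ y, ramp x δ y * v₂ y s := by
      simp only [hu, mul_sub]
      exact integral_sub (integrable_ramp_mul x (hv₁.integrableOn_Iic hs.1 x) hδ)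
        (integrable_ramp_mul x (hv₂.integrableOn_Iic hs.1 x) hδ)
    have e4 : ∫ r in (0 : ℝ)..s, A x r
        = (∫ r in Ioc 0 s, ∫ y, deriv (deriv (ramp x δ)) y * v₁ y r)
          - ∫ r in Ioc 0 s, ∫ y, deriv (deriv (ramp x δ)) y * v₂ y r := by
      rw [intervalIntegral.integral_of_le hs.1.le,
        setIntegral_congr_fun measurableSet_Ioc fun r hr => hAeq x r hr.1]
      have hint : ∀ {v : ℝ → ℝ → ℝ}, IsCPolLoc v →
          IntegrableOn (fun r => ∫ y, deriv (deriv (ramp x δ)) y * v y r) (Ioc 0 s) := by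
        intro v hv
        obtain ⟨C, -, hC⟩ := hv.exists_integral_bound (hr2c x) (hr2s x) hs.1
        exact Integrable.mono' (integrableOn_const (C := C) (by simp))
          (((hv.continuousOn_integral (hr2c x) (hr2s x)).mono
            Ioc_subset_Ioi_self).aestronglyMeasurable measurableSet_Ioc)
          ((ae_restrict_iff' measurableSet_Ioc).2 (ae_of_all _ hC))
      exact integral_sub (hint h₁.mem_v) (hint h₂.mem_v)
    rw [e3, e1, e2]
    simp only [hU, e4]
    ring
  have hincr : ∀ x, ∀ s t, 0 ≤ s → s ≤ t → t ≤ T → U x t - U x s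
      = 1 / 2 * (∫ r in s..t, A x r) - ((∫ p in timeSlab t \ timeSlab s, ramp x δ p.1 ∂β₁)
        - ∫ p in timeSlab t \ timeSlab s, ramp x δ p.1 ∂β₂) := by
    intro x s t hs hst htT
    have hsub : timeSlab s ⊆ timeSlab t := fun p hp => le_trans hp hst
    rw [setIntegral_sdiff (measurableSet_timeSlab s)
        (h₁.mem_β.integrableOn_ramp x δ (hs.trans hst)) hsub,
      setIntegral_sdiff (measurableSet_timeSlab s)
        (h₂.mem_β.integrableOn_ramp x δ (hs.trans hst)) hsub,
      ← intervalIntegral.integral_interval_sub_left (hAii x t ⟨hs.trans hst, htT⟩)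
        (hAii x s ⟨hs, hst.trans htT⟩)]
    simp only [hU]
    ring
  have hlip : ∀ x, ∀ s t, 0 ≤ s → s ≤ t → t ≤ T →
      |U x t - U x s| ≤ (L * Real.exp (|x| / 2) + 1) * (t - s) := by
    intro x s t hs hst htT
    rw [hincr x s t hs hst htT]
    have b1 := setIntegral_ramp_nonneg β₁ x δ s t
    have b2 := setIntegral_ramp_nonneg β₂ x δ s t
    have b3 := h₁.mem_β.setIntegral_ramp_le x δ hs hst
    have b4 := h₂.mem_β.setIntegral_ramp_le x δ hs hst
    have b5 : ‖∫ r in s..t, A x r‖ ≤ L * Real.exp (|x| / 2) * |t - s| :=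
      intervalIntegral.norm_integral_le_of_norm_le_const fun r hr =>
        hAb x r ⟨hs.trans_lt (uIoc_of_le hst ▸ hr).1, (uIoc_of_le hst ▸ hr).2.trans htT⟩
    rw [Real.norm_eq_abs, abs_of_nonneg (sub_nonneg.2 hst)] at b5
    have b6 := abs_le.1 b5
    have b7 := (abs_nonneg _).trans b5
    rw [abs_le]
    constructor <;> nlinarith
  have hU0 : ∀ x, U x 0 = 0 := by
    intro x
    have z1 : β₁.restrict (timeSlab 0) = 0 := by
      rw [Measure.restrict_eq_zero, h₁.mem_β.measure_timeSlab le_rfl, ENNReal.ofReal_zero]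
    have z2 : β₂.restrict (timeSlab 0) = 0 := by
      rw [Measure.restrict_eq_zero, h₂.mem_β.measure_timeSlab le_rfl, ENNReal.ofReal_zero]
    simp [hU, z1, z2]
  -- If `v₁ (x - δ) t = 0`, the integrand of `u` is nonpositive left of `x - δ`. The window of
  -- length `δ` contributes at most `δ K e^(|x|/2) ≤ 2 δ K cosh x < ε cosh x`.
  have hvpos : ∀ x, ∀ t ∈ Ioc 0 T, ε * Real.cosh x < U x t → 0 < v₁ (x - δ) t := by
    intro x t ⟨ht, htT⟩ hUbig
    have w1 := (hv₁.slice t ht).1.1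
    have w2 := (hv₂.slice t ht).1.1
    refine lt_of_le_of_ne (w1.nonneg _) fun heq => ?_
    have hle : u x t ≤ δ * (K * Real.exp (|x| / 2)) := by
      have : δ * (K * Real.exp (|x| / 2)) = ∫ y, (Icc (x - δ) x).indicator
          (fun _ => K * Real.exp (|x| / 2)) y := by
        rw [integral_indicator measurableSet_Icc, setIntegral_const]
        simp only [Real.volume_real_Icc, smul_eq_mul, sub_sub_cancel, max_eq_left hδ.le]
      rw [this]
      refine integral_mono (integrable_ramp_mul x (hi t ht x) hδ) ?_ fun y => ?_
      · rw [integrable_indicator_iff measurableSet_Icc]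
        exact integrableOn_const (by simp)
      · have n1 := w1.nonneg y
        have n2 := w2.nonneg y
        have r0 := ramp_nonneg x δ y
        have r1 := ramp_le_one x δ y
        by_cases hy : y ∈ Icc (x - δ) x
        · rw [indicator_of_mem hy]
          have := (w1.mono hy.2).trans (hK₁ x t ⟨ht, htT⟩)
          simp only at this n1 n2 ⊢
          nlinarith
        · rw [indicator_of_notMem hy]
          rw [mem_Icc, not_and_or, not_le, not_le] at hy
          rcases hy with hy | hy
          · have := w1.mono hy.le
            simp only at this n1 n2 ⊢
            rw [← heq] at this
            nlinarith
          · simp only [ramp_eq_zero hδ hy.le, zero_mul, le_refl]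
    rw [huU x t ⟨ht, htT⟩] at hle
    have e1 := exp_half_le_two_mul_cosh x
    have e2 : δ * (K * Real.exp (|x| / 2)) ≤ 2 * (δ * K) * Real.cosh x := by
      have := mul_le_mul_of_nonneg_left e1 (mul_pos hδ hK).le
      linarith
    have e3 := mul_lt_mul_of_pos_right hδε (Real.cosh_pos x)
    linarith
  change u x₀ T ≤ _
  rw [huU x₀ T ⟨hT, le_rfl⟩]
  have hUu : ∀ s ∈ Ioc 0 T, (fun x => U x s) = fun x => u x s := fun s hs =>
    funext fun x => (huU x s hs).symm
  refine le_mul_exp_mul_cosh_of_subsolution (A := A) hT hε hL0 hU0 (fun s hs => ?_)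
    (fun s hs => ?_) hAc hlip (fun x t ht hbig => ?_) x₀
  · rw [hUu s hs]
    exact (deriv_integral_ramp_mul (hcw s hs.1) (hi s hs.1) hδ).1
  · rw [hUu s hs]
    exact (deriv_integral_ramp_mul (hcw s hs.1) (hi s hs.1) hδ).2
  -- Continuity keeps `v₁ (x - δ)` positive shortly before `t`, so `β₁` contributes exactly `t - s`
  -- and `β₂` at most that: the measure terms have the favourable sign.
  · have hev : ∀ᶠ r in 𝓝 t, 0 < r ∧ 0 < v₁ (x - δ) r := by
      have hc : ContinuousOn (fun r => v₁ (x - δ) r) (Ioi 0) :=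
        hv₁.cont.comp (f := fun r => (x - δ, r)) (by fun_prop : Continuous _).continuousOn
          fun r hr => ⟨mem_univ _, hr⟩
      exact (eventually_gt_nhds ht.1).and
        ((hc.continuousAt (Ioi_mem_nhds ht.1)).eventually_const_lt (hvpos x t ht hbig))
    obtain ⟨l, hl, hIoc⟩ := exists_Ioc_subset_of_mem_nhds hev ⟨0, ht.1⟩
    filter_upwards [Ioo_mem_nhdsLT (show l < t from hl)] with s hs
    have hgood : ∀ r ∈ Icc s t, 0 < r ∧ 0 < v₁ (x - δ) r :=
      fun r hr => hIoc ⟨hs.1.trans_le hr.1, hr.2⟩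
    have hs0 : 0 ≤ s := (hgood s ⟨le_rfl, hs.2.le⟩).1.le
    rw [hincr x s t hs0 hs.2.le ht.2, h₁.setIntegral_ramp_eq hδ hs0 hs.2.le
      fun r hr => (hgood r ⟨hr.1.le, hr.2⟩).2]
    linarith [h₂.mem_β.setIntegral_ramp_le x δ hs0 hs.2.le]

/-- Comparison of the primitives of two solutions. -/
theorem setIntegral_Iio_sub_nonpos {v₀ : ℝ → ℝ} {v₁ v₂ : ℝ → ℝ → ℝ}
    {β₁ β₂ : Measure (ℝ × ℝ≥0)} (hv₀ : IsVPolZero v₀) (hv₁ : IsCPolSharpLoc v₁)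
    (hv₂ : IsCPolSharpLoc v₂) (h₁ : IsMFBPSolution v₀ v₁ β₁) (h₂ : IsMFBPSolution v₀ v₂ β₂)
    {t : ℝ} (ht : 0 < t) (x : ℝ) : ∫ y in Iio x, (v₁ y t - v₂ y t) ≤ 0 := by
  obtain ⟨K₁, hK₁, hb₁⟩ := hv₁.growth.exists_exp_bound ht
  obtain ⟨K₂, hK₂, hb₂⟩ := hv₂.growth.exists_exp_bound ht
  have hlim := tendsto_integral_ramp_mul x
    ((hv₁.integrableOn_Iic ht x).sub (hv₂.integrableOn_Iic ht x))
  simp only [Pi.sub_apply] at hlim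
  have hK : 0 < K₁ + K₂ := add_pos hK₁ hK₂
  have hC : 0 < Real.exp t * Real.cosh x := mul_pos (Real.exp_pos t) (Real.cosh_pos x)
  refine le_of_forall_pos_le_add fun η hη => ?_
  rw [zero_add]
  -- Chosen so that the barrier at `(x, t)` equals `η`.
  set ε : ℝ := η / (Real.exp t * Real.cosh x) with hε
  have hε0 : 0 < ε := div_pos hη hC
  have hεη : ε * Real.exp t * Real.cosh x = η := by
    rw [mul_assoc, hε, div_mul_cancel₀ _ hC.ne']
  rw [← hεη]
  refine le_of_tendsto hlim ?_
  have hsmall : Tendsto (fun n : ℕ => 2 * (1 / ((n : ℝ) + 1) * (K₁ + K₂))) atTop (𝓝 0) := by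
    simpa using ((tendsto_one_div_add_atTop_nhds_zero_nat (𝕜 := ℝ)).mul_const (K₁ + K₂)).const_mul 2
  filter_upwards [hsmall.eventually_lt_const hε0] with n hn
  exact integral_ramp_mul_sub_le hv₀ hv₁ hv₂ h₁ h₂ ht
    (fun y s hs => (hb₁ y s hs).trans
      (mul_le_mul_of_nonneg_right (by linarith) (Real.exp_pos _).le))
    (fun y s hs => (hb₂ y s hs).trans
      (mul_le_mul_of_nonneg_right (by linarith) (Real.exp_pos _).le))
    hK hε0 (by positivity) hn x

/-! ### Recovering the solution and the measure. -/

theorem eq_zero_of_setIntegral_Iio_eq_zero {w : ℝ → ℝ} (hw : Continuous w)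
    (hi : ∀ x, IntegrableOn w (Iic x)) (h0 : ∀ x, ∫ y in Iio x, w y = 0) (x : ℝ) : w x = 0 := by
  have h1 : ∀ z, ∫ y in (0 : ℝ)..z, w y = 0 := fun z => by
    rw [← intervalIntegral.integral_Iic_sub_Iic (hi 0) (hi z), integral_Iic_eq_integral_Iio,
      integral_Iic_eq_integral_Iio, h0, h0, sub_zero]
  have h2 := hw.deriv_integral w 0 x
  simp only [h1, deriv_const] at h2
  exact h2.symm

/-- Ramp integrals, which the equation controls, determine the mass of the quadrants on which
`IsMOne.ext` tests equality. -/
theorem IsMOne.tendsto_setIntegral_ramp {β : Measure (ℝ × ℝ≥0)} (hβ : IsMOne β) (x : ℝ) (t : ℝ≥0) :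
    Tendsto (fun n : ℕ => ∫ p in timeSlab t, ramp x (1 / (n + 1)) p.1 ∂β) atTop
      (𝓝 (β.real (Iio x ×ˢ Iic t))) := by
  have := hβ.isFiniteMeasure_restrict t.coe_nonneg
  have hm : MeasurableSet (Iio x ×ˢ Iic t) := measurableSet_Iio.prod measurableSet_Iic
  have e : β.real (Iio x ×ˢ Iic t)
      = ∫ p in timeSlab t, (Iio x).indicator (fun _ => (1 : ℝ)) p.1 ∂β := by
    rw [← integral_indicator_one hm, ← integral_indicator (measurableSet_timeSlab _)]
    congr 1
    funext p
    by_cases h1 : p.1 < x <;> by_cases h2 : p.2 ≤ t <;>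
      simp [indicator, timeSlab, h1, h2]
  rw [e]
  refine tendsto_integral_of_dominated_convergence (fun _ => 1)
    (fun n => ((continuous_ramp x _).comp continuous_fst).aestronglyMeasurable)
    (integrable_const _) (fun n => ae_of_all _ fun p => abs_ramp_le_one _ _ _)
    (ae_of_all _ fun p => tendsto_ramp x p.1)

theorem IsMOne.ext {β₁ β₂ : Measure (ℝ × ℝ≥0)} (hβ₁ : IsMOne β₁) (hβ₂ : IsMOne β₂)
    (h : ∀ (x : ℝ) (t : ℝ≥0), β₁.real (Iio x ×ˢ Iic t) = β₂.real (Iio x ×ˢ Iic t)) :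
    β₁ = β₂ := by
  have hfin : ∀ {β : Measure (ℝ × ℝ≥0)}, IsMOne β → ∀ (x : ℝ) (t : ℝ≥0),
      β (Iio x ×ˢ Iic t) ≠ ⊤ := by
    intro β hβ x t
    refine ne_top_of_le_ne_top (ENNReal.coe_ne_top (r := t)) ?_
    rw [← hβ t]
    exact measure_mono fun p hp => ⟨mem_univ _, zero_le, hp.2⟩
  have hUx : ⋃ n : ℕ, Iio (n : ℝ) = univ :=
    eq_univ_of_forall fun x => mem_iUnion.2 (exists_nat_gt x)
  have hUt : ⋃ n : ℕ, Iic (n : ℝ≥0) = univ :=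
    eq_univ_of_forall fun x => mem_iUnion.2 (exists_nat_ge x)
  refine Measure.ext_of_generateFrom_of_iUnion
    (image2 (· ×ˢ ·) (range (Iio : ℝ → Set ℝ)) (range (Iic : ℝ≥0 → Set ℝ≥0)))
    (fun n => Iio (n : ℝ) ×ˢ Iic (n : ℝ≥0)) ?_ (isPiSystem_Iio.prod isPiSystem_Iic) ?_ ?_ ?_ ?_
  · refine (generateFrom_eq_prod ?_ ?_ ?_ ?_).symm
    · rw [← borel_eq_generateFrom_Iio, BorelSpace.measurable_eq (α := ℝ)]
    · rw [← borel_eq_generateFrom_Iic, BorelSpace.measurable_eq (α := ℝ≥0)]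
    · exact ⟨fun n : ℕ => Iio (n : ℝ), fun n => ⟨_, rfl⟩, hUx⟩
    · exact ⟨fun n : ℕ => Iic (n : ℝ≥0), fun n => ⟨_, rfl⟩, hUt⟩
  · refine eq_univ_of_forall fun p => mem_iUnion.2 ?_
    obtain ⟨m, hm⟩ := exists_nat_gt p.1
    obtain ⟨n, hn⟩ := exists_nat_ge p.2
    exact ⟨max m n, lt_of_lt_of_le hm (Nat.cast_le.2 (le_max_left m n)),
      hn.trans (Nat.cast_le.2 (le_max_right m n))⟩
  · exact fun n => ⟨_, ⟨_, rfl⟩, _, ⟨_, rfl⟩, rfl⟩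
  · exact fun n => hfin hβ₁ _ _
  · rintro _ ⟨_, ⟨x, rfl⟩, _, ⟨t, rfl⟩, rfl⟩
    exact (measureReal_eq_measureReal_iff (hfin hβ₁ x t) (hfin hβ₂ x t)).1 (h x t)

theorem theorem4p1 (v₀ : ℝ → ℝ) (hv₀ : IsVPolZero v₀)
    (v₁ v₂ : ℝ → ℝ → ℝ) (β₁ β₂ : Measure (ℝ × ℝ≥0))
    (hv₁ : IsCPolSharpLoc v₁) (hv₂ : IsCPolSharpLoc v₂)
    (hβ₁ : IsMOne β₁) (hβ₂ : IsMOne β₂)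
    (h₁ : IsMFBPSolution v₀ v₁ β₁) (h₂ : IsMFBPSolution v₀ v₂ β₂) :
    (∀ x t : ℝ, 0 < t → v₁ x t = v₂ x t) ∧ β₁ = β₂ := by
  have hv : ∀ x t : ℝ, 0 < t → v₁ x t = v₂ x t := by
    intro x t ht
    have hi : ∀ x, IntegrableOn (fun y => v₁ y t - v₂ y t) (Iic x) := fun x =>
      (hv₁.integrableOn_Iic ht x).sub (hv₂.integrableOn_Iic ht x)
    refine sub_eq_zero.1 (eq_zero_of_setIntegral_Iio_eq_zero (w := fun y => v₁ y t - v₂ y t)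
      ((hv₁.slice t ht).2.sub (hv₂.slice t ht).2) hi (fun z => ?_) x)
    refine le_antisymm (setIntegral_Iio_sub_nonpos hv₀ hv₁ hv₂ h₁ h₂ ht z) ?_
    have := setIntegral_Iio_sub_nonpos hv₀ hv₂ hv₁ h₂ h₁ ht z
    rw [← neg_nonneg, ← integral_neg] at this
    simpa only [neg_sub] using this
  refine ⟨hv, hβ₁.ext hβ₂ fun x t => ?_⟩
  refine tendsto_nhds_unique (hβ₁.tendsto_setIntegral_ramp x t)
    ((hβ₂.tendsto_setIntegral_ramp x t).congr fun n => ?_)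
  -- The ramp identity needs `t > 0`; at time `0` both measures vanish on the slab. For `t > 0`,
  -- equality of `v₁` and `v₂` matches every term of the identity except the measure integrals,
  -- which must then agree.
  rcases t.coe_nonneg.eq_or_lt with h0 | ht
  · rw [← h0, Measure.restrict_eq_zero.2, Measure.restrict_eq_zero.2]
    · rw [hβ₁.measure_timeSlab le_rfl, ENNReal.ofReal_zero]
    · rw [hβ₂.measure_timeSlab le_rfl, ENNReal.ofReal_zero]
  · have hδ : (0 : ℝ) < 1 / (n + 1) := by positivity
    have e₁ := h₁.ramp_identity hv₀ hv₁ x hδ ht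
    have e₂ := h₂.ramp_identity hv₀ hv₂ x hδ ht
    have e₃ : ∫ r in Ioc 0 (t : ℝ), ∫ y, deriv (deriv (ramp x (1 / (n + 1)))) y * v₁ y r
        = ∫ r in Ioc 0 (t : ℝ), ∫ y, deriv (deriv (ramp x (1 / (n + 1)))) y * v₂ y r :=
      setIntegral_congr_fun measurableSet_Ioc fun r hr => by simp only [hv _ r hr.1]
    simp only [hv _ _ ht] at e₁
    rw [e₃] at e₁
    linarith
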